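/- Let $\mathcal S(]-\infty,0])$ be the space of functions $F\in C^\infty(]-\infty,0],\mathbb C)$ with $\lim_{t\to-\infty}|t|^mF^{(n)}(t)=0$ for all integers $m,n\ge 0$. For $F\in\mathcal S(]-\infty,0])$ the function $$s\longmapsto \frac1{\Gamma(-s)}\int_0^{+\infty}u^{-s-1}F(-u)\,du\qquad(\Re s<0)$$ extends uniquely to an entire function of $s$, denoted $F^{(s)}(0)$. Let $r_n=\#\{(a,b)\in\mathbb Z^2: a^2+b^2=n\}$, let $L(s,\chi_4)$ be the entire continuation of $\sum_{k\ge0}(-1)^k(2k+1)^{-s}$, and put $$\xi(s)=\pi^{-s/2}\Gamma(\tfrac s2)\zeta(s),\qquad \xi_4(s)=2^s\pi^{-(s+1)/2}\Gamma(\tfrac{s+1}2)L(s,\chi_4).$$ Integrals over $\Re s=c$ are taken along the upward vertical line. **Euler-Circle formula.** For every $F\in\mathcal S(]-\infty,0])$ and $t<0$, the series and all the integrals below converge absolutely, and $$\frac1{2i\pi}\int_{\Re s=3/2}\zeta(s)L(s,\chi_4)\Gamma(s)F^{(-s)}(0)(-t)^{-s}\,ds=\frac14\sum_{n\ge1}r_nF(nt),$$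 $$\frac14\sum_{n\ge1}r_nF(nt)=-\frac{L(1,\chi_4)}{t}F^{(-1)}(0)-\frac{L(0,\chi_4)}2F(0)+\frac1{2i\pi}\int_{\Re s=-1/2}\Gamma(s)\zeta(s)L(s,\chi_4)F^{(-s)}(0)(-t)^{-s}\,ds$$ $$=-\frac{\pi}{4t}F^{(-1)}(0)-\frac14F(0)+\frac1{2i\pi}\int_{\Re s=-1/2}\Gamma(s)\zeta(s)L(s,\chi_4)F^{(-s)}(0)(-t)^{-s}\,ds,$$ and, for every real $c>0$, $$\frac14\sum_{n\ge1}r_nF(nt)=-\frac{\pi}{4t}F^{(-1)}(0)-\frac14F(0)+\frac1{2i\pi}\int_{\Re s=c}\Gamma(-s)\zeta(-s)L(-s,\chi_4)F^{(s)}(0)(-t)^s\,ds$$ $$=-\frac{\pi}{4t}F^{(-1)}(0)-\frac14F(0)+\frac1{4i\pi}\int_{\Re s=c}\xi(s+1)\,\xi_4(s+1)\,F^{(s)}(0)\Bigl(\frac{-t}{\pi}\Bigr)^{s}ds .$$ (At the removable singularities $s=1,2,3,\dots$ of the integrand $\Gamma(-s)\zeta(-s)L(-s,\chi_4)F^{(s)}(0)(-t)^s$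 its value is immaterial.) Consequently the regular part of the asymptotic expansion as $t\to0^-$ is stationary from order $0$: for every real $c>0$, $$\frac14\sum_{n\ge1}r_nF(nt)=-\frac{\pi}{4t}F^{(-1)}(0)-\frac14F(0)+O\bigl((-t)^c\bigr)\qquad(t\to0^-).$$ -/

import Mathlib

open Complex Filter Topology MeasureTheory

/-- The space `S(]-∞,0], ℂ)`: functions that are `C^∞` on the closed half-line `]-∞,0]` (one-sided
derivatives at `0`) and all of whose derivatives decrease rapidly at `-∞`. -/
structure IsSchwartzHalfLine (F : ℝ → ℂ) : Prop where
  smooth : ContDiffOn ℝ (⊤ : ℕ∞) F (Set.Iic 0)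
  decay : ∀ m n : ℕ, Tendsto
    (fun t : ℝ => ((|t| ^ m : ℝ) : ℂ) * iteratedDerivWithin n F (Set.Iic 0) t) atBot (𝓝 0)

/-- The fractional primitive of `F` at `0`,
`(1 / Γ(-s)) ∫_0^∞ u^{-s-1} F(-u) du`, meant for `Re s < 0`. -/
noncomputable def fracPrimitive (F : ℝ → ℂ) (s : ℂ) : ℂ :=
  1 / Complex.Gamma (-s) * ∫ u in Set.Ioi (0 : ℝ), (u : ℂ) ^ (-s - 1) * F (-u)

open Classical in
/-- The fractional derivative `F^{(s)}(0)`, `s ∈ ℂ`: the entire function of `s` that extends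
`fracPrimitive F` from the half-plane `Re s < 0` (unique by the identity theorem; the value `0` is a
default for functions `F` without such an extension). -/
noncomputable def fracDeriv (F : ℝ → ℂ) : ℂ → ℂ :=
  if h : ∃ D : ℂ → ℂ, Differentiable ℂ D ∧ ∀ s : ℂ, s.re < 0 → D s = fracPrimitive F s
  then h.choose else 0

/-- `r_n`, the number of pairs `(a, b) ∈ ℤ²` with `a² + b² = n`. -/
noncomputable def sumTwoSquaresCount (n : ℕ) : ℕ :=
  Set.ncard {p : ℤ × ℤ | p.1 ^ 2 + p.2 ^ 2 = (n : ℤ)}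

/-- `L(s, χ₄)`, the entire continuation of `∑ (-1)^k / (2k+1)^s`. -/
noncomputable def LChi4 (s : ℂ) : ℂ :=
  DirichletCharacter.LFunction (ZMod.χ₄.ringHomComp (Int.castRingHom ℂ)) s

/-- `ξ(s) = π^{-s/2} Γ(s/2) ζ(s)`. -/
noncomputable def xiZeta (s : ℂ) : ℂ :=
  (Real.pi : ℂ) ^ (-s / 2) * Complex.Gamma (s / 2) * riemannZeta s

/-- `ξ₄(s) = 2^s π^{-(s+1)/2} Γ((s+1)/2) L(s, χ₄)`. -/
noncomputable def xiChi4 (s : ℂ) : ℂ :=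
  (2 : ℂ) ^ s * (Real.pi : ℂ) ^ (-(s + 1) / 2) * Complex.Gamma ((s + 1) / 2) * LChi4 s

/-- `∫_{Re s = c} f(s) ds` along the vertical line oriented upwards, `s = c + i y`, `ds = i dy`. -/
noncomputable def verticalIntegral (c : ℝ) (f : ℂ → ℂ) : ℂ :=
  Complex.I * ∫ y : ℝ, f (c + y * Complex.I)

/-- The series `∑_{n ≥ 1} r_n F(n t)`. -/
noncomputable def circleSum (F : ℝ → ℂ) (t : ℝ) : ℂ :=
  ∑' n : ℕ, (sumTwoSquaresCount (n + 1) : ℂ) * F (((n + 1 : ℕ) : ℝ) * t)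

/-- The integrand `Γ(s) ζ(s) L(s, χ₄) F^{(-s)}(0) (-t)^{-s}`. -/
noncomputable def circleIntegrand (F : ℝ → ℂ) (t : ℝ) (s : ℂ) : ℂ :=
  Complex.Gamma s * riemannZeta s * LChi4 s * fracDeriv F (-s) * ((-t : ℝ) : ℂ) ^ (-s)

/-- The integrand `ξ(s+1) ξ₄(s+1) F^{(s)}(0) (-t/π)^s`. -/
noncomputable def circleXiIntegrand (F : ℝ → ℂ) (t : ℝ) (s : ℂ) : ℂ :=
  xiZeta (s + 1) * xiChi4 (s + 1) * fracDeriv F s * ((-t / Real.pi : ℝ) : ℂ) ^ s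

/-! For Re s > 1 the product ζ(s) L(s, χ₄) is the Dirichlet series of ∑_{d ∣ n} χ₄(d), which equals
r_n / 4 by Jacobi's two-square theorem (`sumTwoSquaresCount_eq`). Since Γ(s) F^{(-s)}(0) is the
Mellin transform of u ↦ F(-u), termwise Mellin inversion produces the integral over Re s = 3/2
(`hasSum_circle`, `tsum_circle`).

The duplication formula merges the Gamma factors of ζ and L(·, χ₄) into one Γ(s), so
s(s-1)Γ(s)ζ(s)L(s, χ₄) extends to the entire function `circleXi`, which is symmetric under s ↦ 1-s
up to a power of π. As F^{(-s)}(0) is entire, the integrand has no poles outside {0, 1}. Moving the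
line to any Re s = a < 0 (`contour_shift`) therefore picks up the same two residues, evaluated with
L(1, χ₄) = π/4 and L(0, χ₄) = 1/2, and leaves a remainder O((-t)^{-a}). This is why the expansion is
stationary.

The move needs decay: `circleW`, that is s(s-1) times the coefficient of (-t)^{-s}, is bounded on
vertical strips (`exists_norm_circleW_le`). On a line to the right this follows from absolute
convergence, on a line to the left from the functional equation, in both cases after writing
F^{(-s)}(0) with a high derivative of F, which supplies a denominator Γ(s+n). Phragmén–Lindelöf
covers the strip in between. The integrand is then O(|s|^{-2}). -/

/-! ### Jacobi's two-square theorem via the arithmetic of ℤ[i]. -/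

/-- The Gaussian integers of norm `n`. -/
def gaussianNormSet (n : ℕ) : Set GaussianInt := {z | z.norm = (n : ℤ)}

theorem GaussianInt.norm_eq_sq_add_sq (z : GaussianInt) : z.norm = z.re ^ 2 + z.im ^ 2 := by
  rw [Zsqrtd.norm_def]; ring

theorem sumTwoSquaresCount_eq_ncard (n : ℕ) :
    sumTwoSquaresCount n = (gaussianNormSet n).ncard := by
  refine Set.ncard_congr (fun p _ => (⟨p.1, p.2⟩ : GaussianInt)) ?_ ?_ ?_
  · rintro ⟨a, b⟩ h
    simpa [gaussianNormSet, GaussianInt.norm_eq_sq_add_sq] using h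
  · rintro ⟨a, b⟩ ⟨c, d⟩ _ _ h
    simpa [Zsqrtd.ext_iff] using h
  · rintro ⟨a, b⟩ h
    refine ⟨(a, b), ?_, rfl⟩
    simpa [gaussianNormSet, GaussianInt.norm_eq_sq_add_sq] using h

theorem finite_gaussianNormSet (n : ℕ) : (gaussianNormSet n).Finite := by
  have h : Set.Finite ((fun z : GaussianInt => (z.re, z.im)) ⁻¹'
      (Set.Icc (-(n : ℤ)) n ×ˢ Set.Icc (-(n : ℤ)) n)) := by
    refine Set.Finite.preimage ?_ ((Set.finite_Icc _ _).prod (Set.finite_Icc _ _))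
    rintro ⟨a, b⟩ _ ⟨c, d⟩ _ h
    simpa [Zsqrtd.ext_iff] using h
  refine h.subset fun z hz => ?_
  have hz' : z.re ^ 2 + z.im ^ 2 = (n : ℤ) := by
    rw [← GaussianInt.norm_eq_sq_add_sq]; exact hz
  have key : ∀ a b : ℤ, a ^ 2 + b ^ 2 = (n : ℤ) → -(n : ℤ) ≤ a ∧ a ≤ n := by
    intro a b hab
    have h1 := Int.le_self_sq a
    have h2 := Int.le_self_sq (-a)
    have h3 := sq_nonneg b
    constructor <;> nlinarith
  exact ⟨key _ _ hz', key _ _ (by rw [add_comm]; exact hz')⟩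

theorem ncard_gaussianNormSet_dvd {w : GaussianInt} {m : ℕ} (hm : m ≠ 0) (hw : w.norm = m) (n : ℕ) :
    {z ∈ gaussianNormSet (m * n) | w ∣ z}.ncard = (gaussianNormSet n).ncard := by
  symm
  have hw0 : w ≠ 0 := by
    rintro rfl
    simp at hw
    exact hm (by exact_mod_cast hw.symm)
  refine Set.ncard_congr (fun z _ => w * z) ?_ ?_ ?_
  · intro z hz
    refine ⟨?_, Dvd.intro _ rfl⟩
    simp only [gaussianNormSet, Set.mem_ofPred_eq] at hz ⊢
    rw [Zsqrtd.norm_mul, hw, hz]; push_cast; rfl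
  · intro z z' _ _ h
    exact mul_left_cancel₀ hw0 h
  · rintro z ⟨hz, k, rfl⟩
    refine ⟨k, ?_, rfl⟩
    simp only [gaussianNormSet, Set.mem_ofPred_eq] at hz ⊢
    rw [Zsqrtd.norm_mul, hw] at hz
    push_cast at hz
    exact mul_left_cancel₀ (by exact_mod_cast hm) hz

theorem GaussianInt.prime_of_norm_prime {w : GaussianInt} {p : ℕ} (hp : p.Prime)
    (hw : w.norm = p) : Prime w := by
  rw [← irreducible_iff_prime]
  have hw' : w.norm.natAbs = p := by rw [hw]; simp
  refine ⟨fun h => ?_, fun a b hab => ?_⟩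
  · rw [← Zsqrtd.norm_eq_one_iff, hw'] at h
    exact hp.one_lt.ne' h
  · rw [← Zsqrtd.norm_eq_one_iff, ← Zsqrtd.norm_eq_one_iff]
    rw [hab, Zsqrtd.norm_mul, Int.natAbs_mul] at hw'
    exact (Nat.prime_mul_iff.mp (hw' ▸ hp)).elim (fun h => Or.inr h.2) (fun h => Or.inl h.2)

theorem dvd_mul_star_of_mem_gaussianNormSet {w z : GaussianInt} {p n : ℕ} (hw : w.norm = p)
    (hz : z ∈ gaussianNormSet (p * n)) : w ∣ z * star z := by
  have : z.norm = ((p * n : ℕ) : ℤ) := hz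
  rw [← Zsqrtd.norm_eq_mul_conj, this, Nat.cast_mul, ← hw]
  push_cast
  rw [Zsqrtd.norm_eq_mul_conj, mul_assoc]
  exact Dvd.intro _ rfl

/-- The number of Gaussian integers of norm `n / p`, read as `0` when `p` does not divide `n`. -/
noncomputable def gaussianCountDiv (p n : ℕ) : ℕ :=
  if p ∣ n then (gaussianNormSet (n / p)).ncard else 0

/-- The Gaussian integer p has norm p², so dividing by it turns norm pn into norm n / p; when p ∤ n
no multiple of p has norm pn. -/
theorem ncard_gaussianNormSet_prime_dvd {p : ℕ} (hp : p.Prime) (n : ℕ) :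
    {z ∈ gaussianNormSet (p * n) | (p : GaussianInt) ∣ z}.ncard = gaussianCountDiv p n := by
  have hn : ((p : GaussianInt)).norm = ((p * p : ℕ) : ℤ) := by
    rw [Zsqrtd.norm_natCast]; push_cast; rfl
  unfold gaussianCountDiv
  split_ifs with h
  · obtain ⟨k, rfl⟩ := h
    rw [Nat.mul_div_cancel_left _ hp.pos, ← mul_assoc]
    exact ncard_gaussianNormSet_dvd (mul_ne_zero hp.ne_zero hp.ne_zero) hn k
  · convert Set.ncard_empty (α := GaussianInt)
    ext z
    simp only [Set.mem_ofPred_eq, Set.mem_empty_iff_false, iff_false, not_and]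
    rintro hz ⟨k, rfl⟩
    simp only [gaussianNormSet, Set.mem_ofPred_eq] at hz
    rw [Zsqrtd.norm_mul, hn] at hz
    push_cast at hz
    rw [mul_assoc] at hz
    have := mul_left_cancel₀ (by exact_mod_cast hp.ne_zero) hz
    exact h (by exact_mod_cast Dvd.intro _ this)

/-- The three cases are the splitting types of p in ℤ[i]. For p = 2 (ramified), every z of norm 2n
is divisible by 1 + i. For p ≡ 3 mod 4 (inert), p itself divides z. For p ≡ 1 mod 4, p is the
product of two non-associate primes w and its conjugate; each z is divisible by one of them, and
inclusion–exclusion counts those divisible by both, hence by p. -/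
theorem gaussianCount_prime_mul {p : ℕ} (hp : p.Prime) (n : ℕ) :
    ((gaussianNormSet (p * n)).ncard : ℤ) + ZMod.χ₄ p * gaussianCountDiv p n =
      (1 + ZMod.χ₄ p) * (gaussianNormSet n).ncard := by
  have := Fact.mk hp
  rcases hp.eq_two_or_odd with rfl | hodd
  · have h2 : (gaussianNormSet (2 * n)).ncard = (gaussianNormSet n).ncard := by
      have hw : (⟨1, 1⟩ : GaussianInt).norm = (2 : ℕ) := by
        simp [GaussianInt.norm_eq_sq_add_sq]
      rw [← ncard_gaussianNormSet_dvd two_ne_zero hw n]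
      congr 1
      ext z
      simp only [Set.mem_ofPred_eq]
      refine ⟨fun h => ⟨h, ?_⟩, fun h => h.1⟩
      rcases (GaussianInt.prime_of_norm_prime Nat.prime_two hw).dvd_or_dvd
        (dvd_mul_star_of_mem_gaussianNormSet hw h) with h | ⟨k, hk⟩
      · exact h
      · refine ⟨⟨0, -1⟩ * star k, ?_⟩
        rw [← star_star z, hk, star_mul]
        ext <;> simp; ring
    rw [h2]
    have : ZMod.χ₄ ((2 : ℕ) : ZMod 4) = 0 := by decide
    rw [this]; ring
  · by_cases h3 : p % 4 = 3
    · have hc : ZMod.χ₄ p = -1 := ZMod.χ₄_nat_three_mod_four h3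
      have hP := GaussianInt.prime_of_nat_prime_of_mod_four_eq_three p h3
      have : gaussianNormSet (p * n) = {z ∈ gaussianNormSet (p * n) | (p : GaussianInt) ∣ z} := by
        ext z
        simp only [Set.mem_ofPred_eq]
        refine ⟨fun h => ⟨h, ?_⟩, fun h => h.1⟩
        have hz : (p : GaussianInt) ∣ z * star z := by
          have : z.norm = ((p * n : ℕ) : ℤ) := h
          rw [← Zsqrtd.norm_eq_mul_conj, this]
          push_cast
          exact Dvd.intro _ rfl
        rcases hP.dvd_or_dvd hz with h | ⟨k, hk⟩
        · exact h
        · refine ⟨star k, ?_⟩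
          rw [← star_star z, hk, star_mul, star_natCast, mul_comm]
      rw [this, ncard_gaussianNormSet_prime_dvd hp, hc]
      ring
    · have h1 : p % 4 = 1 := by omega
      have hc : ZMod.χ₄ p = 1 := ZMod.χ₄_nat_one_mod_four h1
      obtain ⟨a, b, hab⟩ := Nat.Prime.sq_add_sq h3
      set w : GaussianInt := ⟨a, b⟩ with hwdef
      have hw : w.norm = p := by
        rw [GaussianInt.norm_eq_sq_add_sq, ← hab]; push_cast; rfl
      have hw' : (star w).norm = p := by rw [Zsqrtd.norm_conj, hw]
      have hP := GaussianInt.prime_of_norm_prime hp hw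
      have hpw : (p : GaussianInt) = w * star w := by
        rw [← Zsqrtd.norm_eq_mul_conj, hw]; simp
      -- Otherwise w divides w + star w = 2a, and norms give p ∣ 4a². As p is odd, p ∣ a, then p ∣
      -- b, so p² divides a² + b² = p.
      have hnd : ¬ w ∣ star w := by
        intro h
        have h2 : w ∣ ((2 * a : ℤ) : GaussianInt) := by
          have : ((2 * a : ℤ) : GaussianInt) = w + star w := by
            ext <;> simp [hwdef]; ring
          rw [this]
          exact dvd_add dvd_rfl h
        obtain ⟨k, hk⟩ := h2
        have h4 := congrArg Zsqrtd.norm hk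
        rw [Zsqrtd.norm_intCast, Zsqrtd.norm_mul, hw] at h4
        have h5 : (p : ℤ) ∣ (2 * a) * (2 * a) := Dvd.intro _ h4.symm
        have h6 : p ∣ (2 * a) * (2 * a) := by exact_mod_cast h5
        have h7 : p ∣ a := by
          rcases (Nat.Prime.dvd_mul hp).mp ((Nat.Prime.dvd_mul hp).mp h6 |>.elim id id) with h | h
          · have := Nat.le_of_dvd two_pos h
            have := hp.two_le
            omega
          · exact h
        have h8 : p ∣ b := by
          have : p ∣ a ^ 2 + b ^ 2 := by rw [hab]
          exact hp.dvd_of_dvd_pow ((Nat.dvd_add_right (dvd_pow h7 two_ne_zero)).mp this)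
        obtain ⟨a', rfl⟩ := h7
        obtain ⟨b', rfl⟩ := h8
        have h9 : p * (p * (a' ^ 2 + b' ^ 2)) = p * 1 := by
          rw [mul_one]; nth_rw 3 [← hab]; ring
        have h10 := Nat.eq_of_mul_eq_mul_left hp.pos h9
        exact hp.one_lt.ne' (Nat.eq_one_of_mul_eq_one_right h10)
      have hU : gaussianNormSet (p * n) = {z ∈ gaussianNormSet (p * n) | w ∣ z} ∪
          {z ∈ gaussianNormSet (p * n) | star w ∣ z} := by
        ext z
        simp only [Set.mem_union, Set.mem_ofPred_eq]
        refine ⟨fun h => ?_, fun h => h.elim And.left And.left⟩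
        rcases hP.dvd_or_dvd (dvd_mul_star_of_mem_gaussianNormSet hw h) with h' | ⟨k, hk⟩
        · exact Or.inl ⟨h, h'⟩
        · refine Or.inr ⟨h, star k, ?_⟩
          rw [← star_star z, hk, star_mul, mul_comm]
      have hI : {z ∈ gaussianNormSet (p * n) | w ∣ z} ∩ {z ∈ gaussianNormSet (p * n) | star w ∣ z}
          = {z ∈ gaussianNormSet (p * n) | (p : GaussianInt) ∣ z} := by
        ext z
        simp only [Set.mem_inter_iff, Set.mem_ofPred_eq]
        constructor
        · rintro ⟨⟨h1, h2⟩, _, k, rfl⟩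
          refine ⟨h1, ?_⟩
          obtain ⟨k', rfl⟩ := (hP.dvd_or_dvd h2).resolve_left hnd
          exact ⟨k', by rw [hpw]; ring⟩
        · rintro ⟨h1, k, rfl⟩
          exact ⟨⟨h1, star w * k, by rw [hpw]; ring⟩, h1, w * k, by rw [hpw]; ring⟩
      have hfin := finite_gaussianNormSet (p * n)
      have := Set.ncard_union_add_ncard_inter {z ∈ gaussianNormSet (p * n) | w ∣ z}
        {z ∈ gaussianNormSet (p * n) | star w ∣ z} (hfin.subset fun z h => h.1)
        (hfin.subset fun z h => h.1)
      rw [← hU, hI, ncard_gaussianNormSet_prime_dvd hp, ncard_gaussianNormSet_dvd hp.ne_zero hw,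
        ncard_gaussianNormSet_dvd hp.ne_zero hw'] at this
      rw [hc]
      zify at this
      linarith

/-- `∑_{d ∣ n} χ₄(d)`. -/
def chi4DivisorSum (n : ℕ) : ℤ := ∑ d ∈ n.divisors, ZMod.χ₄ d

/-- The divisors of pn are D(n) ∪ pD(n), with D(n) ∩ pD(n) equal to pD(n / p), or empty when p ∤ n.
Complete multiplicativity of χ₄ does the rest. The recursion matches `gaussianCount_prime_mul`. -/
theorem chi4DivisorSum_prime_mul {p : ℕ} (hp : p.Prime) {n : ℕ} (hn : n ≠ 0) :
    chi4DivisorSum (p * n) + ZMod.χ₄ p * (if p ∣ n then chi4DivisorSum (n / p) else 0) =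
      (1 + ZMod.χ₄ p) * chi4DivisorSum n := by
  have hmul : ∀ m, ZMod.χ₄ p * chi4DivisorSum m =
      ∑ d ∈ m.divisors.image (p * ·), ZMod.χ₄ d := by
    intro m
    rw [Finset.sum_image fun a _ b _ h => Nat.eq_of_mul_eq_mul_left hp.pos h, chi4DivisorSum,
      Finset.mul_sum]
    simp only [Nat.cast_mul, map_mul]
  have hU : (p * n).divisors = n.divisors ∪ n.divisors.image (p * ·) := by
    rw [Nat.divisors_mul, Nat.Prime.divisors hp]
    ext d
    simp [Finset.mem_mul]
  have hI : n.divisors ∩ n.divisors.image (p * ·) =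
      if p ∣ n then (n / p).divisors.image (p * ·) else ∅ := by
    split_ifs with h
    · obtain ⟨k, rfl⟩ := h
      rw [Nat.mul_div_cancel_left _ hp.pos]
      ext d
      simp only [Finset.mem_inter, Nat.mem_divisors, Finset.mem_image]
      constructor
      · rintro ⟨⟨h1, h2⟩, e, ⟨h3, h4⟩, rfl⟩
        exact ⟨e, ⟨Nat.dvd_of_mul_dvd_mul_left hp.pos h1, (mul_ne_zero_iff.mp h2).2⟩, rfl⟩
      · rintro ⟨e, ⟨h1, h2⟩, rfl⟩
        exact ⟨⟨Nat.mul_dvd_mul_left p h1, hn⟩, e, ⟨dvd_mul_of_dvd_right h1 p, hn⟩, rfl⟩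
    · rw [Finset.eq_empty_iff_forall_notMem]
      intro d
      simp only [Finset.mem_inter, Nat.mem_divisors, Finset.mem_image]
      rintro ⟨⟨h1, _⟩, e, _, rfl⟩
      exact h (dvd_of_mul_right_dvd h1)
  have hS := Finset.sum_union_inter (s₁ := n.divisors) (s₂ := n.divisors.image (p * ·))
    (f := fun d : ℕ => ZMod.χ₄ (d : ZMod 4))
  rw [← hU, hI, ← hmul] at hS
  change chi4DivisorSum (p * n) + _ = chi4DivisorSum n + _ at hS
  split_ifs at hS ⊢ with h
  · rw [hmul]; linarith
  · simp only [Finset.sum_empty] at hS; linarith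

theorem ncard_gaussianNormSet_one : (gaussianNormSet 1).ncard = 4 := by
  have : gaussianNormSet 1 = (({⟨1, 0⟩, ⟨-1, 0⟩, ⟨0, 1⟩, ⟨0, -1⟩} : Finset GaussianInt) :
      Set GaussianInt) := by
    ext ⟨a, b⟩
    simp only [gaussianNormSet, GaussianInt.norm_eq_sq_add_sq, Set.mem_ofPred_eq, Finset.coe_insert,
      Finset.coe_singleton, Set.mem_insert_iff, Set.mem_singleton_iff, Zsqrtd.ext_iff]
    constructor
    · intro h
      push_cast at h
      have ha : -1 ≤ a ∧ a ≤ 1 := by constructor <;> nlinarith [sq_nonneg b]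
      have hb : -1 ≤ b ∧ b ≤ 1 := by constructor <;> nlinarith [sq_nonneg a]
      obtain ⟨ha1, ha2⟩ := ha
      obtain ⟨hb1, hb2⟩ := hb
      interval_cases a <;> interval_cases b <;> simp_all
    · rintro (⟨rfl, rfl⟩ | ⟨rfl, rfl⟩ | ⟨rfl, rfl⟩ | ⟨rfl, rfl⟩) <;> norm_num
  rw [this, Set.ncard_coe_finset]
  decide

/-- **Jacobi's two-square theorem**. -/
theorem sumTwoSquaresCount_eq {n : ℕ} (hn : n ≠ 0) :
    (sumTwoSquaresCount n : ℤ) = 4 * chi4DivisorSum n := by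
  rw [sumTwoSquaresCount_eq_ncard]
  induction n using Nat.strong_induction_on with
  | _ n ih =>
    rcases eq_or_ne n 1 with rfl | h1
    · rw [ncard_gaussianNormSet_one]; simp [chi4DivisorSum]
    · obtain ⟨p, hp, m, rfl⟩ := Nat.exists_prime_and_dvd h1
      have hm : m ≠ 0 := (mul_ne_zero_iff.mp hn).2
      have hlt : m < p * m := by
        have := hp.two_le
        nlinarith [Nat.pos_of_ne_zero hm]
      -- Both sides obey the same recursion from m and m / p to pm, and the induction hypothesis
      -- covers these two smaller arguments.
      have e1 := gaussianCount_prime_mul hp m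
      have e2 := chi4DivisorSum_prime_mul hp hm
      have e3 := ih m hlt hm
      have e4 : (gaussianCountDiv p m : ℤ) =
          4 * (if p ∣ m then chi4DivisorSum (m / p) else 0) := by
        unfold gaussianCountDiv
        split_ifs with h
        · refine ih _ ((Nat.div_le_self _ _).trans_lt hlt) ?_
          exact (Nat.div_pos (Nat.le_of_dvd (Nat.pos_of_ne_zero hm) h) hp.pos).ne'
        · simp
      rw [e4, e3] at e1
      linear_combination e1 - 4 * e2

/-! ### The character χ₄: functional equation and the values L(1, χ₄), L(0, χ₄). -/

/-- The nontrivial Dirichlet character modulo `4`, with complex values. -/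
noncomputable def chi4 : DirichletCharacter ℂ 4 := ZMod.χ₄.ringHomComp (Int.castRingHom ℂ)

theorem chi4_apply (j : ZMod 4) : chi4 j = (ZMod.χ₄ j : ℂ) := rfl

theorem LChi4_eq_LFunction (s : ℂ) : LChi4 s = DirichletCharacter.LFunction chi4 s := rfl

theorem chi4_odd : chi4.Odd := by
  rw [DirichletCharacter.Odd, chi4_apply]
  have : ZMod.χ₄ (-1) = -1 := by decide
  rw [this]; norm_num

theorem chi4_ne_one : chi4 ≠ 1 := by
  intro h
  have := chi4_odd
  rw [h, DirichletCharacter.Odd, MulChar.one_apply isUnit_one.neg] at this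
  norm_num at this

theorem differentiable_LChi4 : Differentiable ℂ LChi4 :=
  DirichletCharacter.differentiable_LFunction chi4_ne_one

/-- The completed `L`-function of `χ₄`. -/
noncomputable def completedLChi4 (s : ℂ) : ℂ := DirichletCharacter.completedLFunction chi4 s

theorem differentiable_completedLChi4 : Differentiable ℂ completedLChi4 :=
  DirichletCharacter.differentiable_completedLFunction chi4_ne_one

theorem LChi4_eq_div (s : ℂ) : LChi4 s = completedLChi4 s / Gammaℝ (s + 1) := by
  rw [LChi4_eq_LFunction, DirichletCharacter.LFunction_eq_completed_div_gammaFactor _ _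
    (Or.inr (by norm_num)), chi4_odd.gammaFactor_def]
  rfl

/-- The additive character on ℤ/4 takes the values 1, i, -1, -i, so the transform can be computed at
each point. It makes the functional equation relate the L-function of χ₄ to itself. -/
theorem dft_chi4 : ZMod.dft (fun j => chi4 j) = fun j => -2 * I * chi4 j := by
  ext k
  have e0 : ZMod.stdAddChar (0 : ZMod 4) = (1 : ℂ) := by simp
  have e1 : ZMod.stdAddChar (1 : ZMod 4) = I := by
    have := ZMod.stdAddChar_coe (N := 4) 1
    rw [Int.cast_one] at this
    rw [this, show 2 * (Real.pi : ℂ) * I * ((1 : ℤ) : ℂ) / ((4 : ℕ) : ℂ) = Real.pi / 2 * I by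
      push_cast; ring, exp_pi_div_two_mul_I]
  have e2 : ZMod.stdAddChar (2 : ZMod 4) = (-1 : ℂ) := by
    rw [show (2 : ZMod 4) = 1 + 1 by decide, AddChar.map_add_eq_mul, e1, I_mul_I]
  have e3 : ZMod.stdAddChar (3 : ZMod 4) = -I := by
    rw [show (3 : ZMod 4) = 1 + 2 by decide, AddChar.map_add_eq_mul, e1, e2]; ring
  rw [ZMod.dft_apply]
  rw [show (Finset.univ : Finset (ZMod 4)) = {0, 1, 2, 3} by decide]
  have c0 : ZMod.χ₄ 0 = 0 := by decide
  have c1 : ZMod.χ₄ 1 = 1 := by decide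
  have c2 : ZMod.χ₄ 2 = 0 := by decide
  have c3 : ZMod.χ₄ 3 = -1 := by decide
  rw [Finset.sum_insert (by decide), Finset.sum_insert (by decide), Finset.sum_insert (by decide),
    Finset.sum_singleton]
  simp only [chi4_apply, c0, c1, c2, c3, smul_eq_mul]
  have hk : k = 0 ∨ k = 1 ∨ k = 2 ∨ k = 3 := by revert k; decide
  rcases hk with rfl | rfl | rfl | rfl
  · simp [c0]
  · rw [show (-(1 * 1) : ZMod 4) = 3 by decide, show (-(3 * 1) : ZMod 4) = 1 by decide, e1, e3, c1]
    push_cast; ring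
  · rw [show (-(1 * 2) : ZMod 4) = 2 by decide, show (-(3 * 2) : ZMod 4) = 2 by decide, e2, c2]
    push_cast; ring
  · rw [show (-(1 * 3) : ZMod 4) = 1 by decide, show (-(3 * 3) : ZMod 4) = 3 by decide, e1, e3, c3]
    push_cast; ring

theorem completedLChi4_one_sub (s : ℂ) :
    completedLChi4 (1 - s) = (2 : ℂ) ^ (2 * s - 1) * completedLChi4 s := by
  have h := ZMod.completedLFunction_one_sub_odd chi4_odd.to_fun s
  rw [show (ZMod.dft (chi4 : ZMod 4 → ℂ)) = _ from dft_chi4, ZMod.completedLFunction_const_mul] at h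
  change completedLChi4 (1 - s) = _ * _ * (_ * completedLChi4 s) at h
  rw [h]
  have : ((4 : ℕ) : ℂ) ^ (s - 1) = (2 : ℂ) ^ (2 * s - 1) / 2 := by
    have h4 := mul_cpow_ofReal_nonneg (a := 2) (b := 2) (by norm_num) (by norm_num) (s - 1)
    rw [show 2 * s - 1 = (s - 1) + (s - 1) + 1 by ring, cpow_add _ _ two_ne_zero,
      cpow_add _ _ two_ne_zero, cpow_one, mul_div_cancel_right₀ _ two_ne_zero]
    norm_num at h4 ⊢
    exact h4
  rw [this]
  linear_combination (-(2 : ℂ) ^ (2 * s - 1) * completedLChi4 s) * I_mul_I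

/-- Pairing consecutive terms of the Leibniz series makes them nonnegative, so convergence of its
even partial sums already gives an unconditional sum. -/
theorem tsum_leibniz_pairs :
    HasSum (fun m : ℕ => (1 / (4 * m + 1) - 1 / (4 * m + 3) : ℝ)) (Real.pi / 4) := by
  have hnn : ∀ m : ℕ, (0 : ℝ) ≤ 1 / (4 * m + 1) - 1 / (4 * m + 3) := by
    intro m
    rw [sub_nonneg]
    exact one_div_le_one_div_of_le (by positivity) (by linarith)
  rw [hasSum_iff_tendsto_nat_of_nonneg hnn]
  have h := Real.tendsto_sum_pi_div_four.comp (tendsto_id.const_mul_atTop' (two_pos (α := ℕ)))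
  refine h.congr fun n => ?_
  simp only [Function.comp, id]
  induction n with
  | zero => simp
  | succ n ih =>
    rw [show 2 * (n + 1) = 2 * n + 1 + 1 by ring, Finset.sum_range_succ, Finset.sum_range_succ, ih,
      Finset.sum_range_succ]
    have : ((-1 : ℝ)) ^ (2 * n) = 1 := by rw [pow_mul]; norm_num
    rw [pow_succ, this]
    push_cast
    ring

theorem LChi4_ofReal {s : ℝ} (hs : 1 < s) :
    LChi4 s = ((∑' m : ℕ, (1 / (4 * m + 1 : ℝ) ^ s - 1 / (4 * m + 3 : ℝ) ^ s) : ℝ) : ℂ) := by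
  have hs' : 1 < ((s : ℝ) : ℂ).re := by simpa using hs
  rw [LChi4_eq_LFunction, DirichletCharacter.LFunction_eq_LSeries _ hs', LSeries]
  have hsum := DirichletCharacter.LSeriesSummable_of_one_lt_re chi4 hs'
  rw [Nat.sumByResidueClasses hsum 4]
  rw [show (Finset.univ : Finset (ZMod 4)) = {0, 1, 2, 3} by decide,
    Finset.sum_insert (by decide), Finset.sum_insert (by decide), Finset.sum_insert (by decide),
    Finset.sum_singleton]
  have c : ∀ (j : ℕ) (m : ℕ), j ≠ 0 → LSeries.term (fun n => chi4 n) s (j + 4 * m) =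
      (((ZMod.χ₄ (j : ZMod 4) : ℝ) * (1 / (4 * m + j : ℝ) ^ s) : ℝ) : ℂ) := by
    intro j m hj
    rw [LSeries.term_of_ne_zero (by omega), chi4_apply]
    have h4 : ((4 : ℕ) : ZMod 4) = 0 := by decide
    have : (((j + 4 * m : ℕ)) : ZMod 4) = j := by
      rw [Nat.cast_add, Nat.cast_mul, h4, zero_mul, add_zero]
    rw [this]
    have h0 : (0 : ℝ) ≤ 4 * m + j := by positivity
    push_cast [ofReal_cpow h0]
    rw [add_comm]; ring
  have c0 : ∀ m : ℕ, LSeries.term (fun n => chi4 n) s (4 * m) = 0 := by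
    intro m
    rcases eq_or_ne m 0 with rfl | hm
    · simp
    · rw [LSeries.term_of_ne_zero (by omega), chi4_apply]
      have h4 : ((4 : ℕ) : ZMod 4) = 0 := by decide
      have : ZMod.χ₄ (((4 * m : ℕ)) : ZMod 4) = 0 := by
        rw [Nat.cast_mul, h4, zero_mul]; decide
      rw [this]; simp
  have v0 : (0 : ZMod 4).val = 0 := rfl
  have v1 : (1 : ZMod 4).val = 1 := rfl
  have v2 : (2 : ZMod 4).val = 2 := rfl
  have v3 : (3 : ZMod 4).val = 3 := rfl
  have d1 : ZMod.χ₄ ((1 : ℕ) : ZMod 4) = 1 := by decide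
  have d2 : ZMod.χ₄ ((2 : ℕ) : ZMod 4) = 0 := by decide
  have d3 : ZMod.χ₄ ((3 : ℕ) : ZMod 4) = -1 := by decide
  have hinj : ∀ j : ℕ, Function.Injective (fun m : ℕ => j + 4 * m) := fun j a b h => by
    simp only at h; omega
  have s1 := hsum.comp_injective (hinj 1)
  have s3 := hsum.comp_injective (hinj 3)
  simp only [Function.comp_def] at s1 s3
  simp only [v0, v1, v2, v3, zero_add, c0, c 1 _ one_ne_zero, c 2 _ two_ne_zero,
    c 3 _ three_ne_zero, d1, d2, d3] at s1 s3 ⊢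
  rw [tsum_zero, zero_add]
  simp only [Int.cast_zero, zero_mul, ofReal_zero, tsum_zero, zero_add]
  rw [← s1.tsum_add s3, ofReal_tsum]
  refine tsum_congr fun m => ?_
  push_cast
  ring

/-- An Abel-type limit s → 1⁺: the left side is continuous because L(·, χ₄) is entire, and the
paired series passes to the limit by dominated convergence. -/
theorem LChi4_one : LChi4 1 = Real.pi / 4 := by
  have h1 : Tendsto (fun s : ℝ => LChi4 s) (𝓝[>] 1) (𝓝 (LChi4 1)) := by
    have : Continuous fun s : ℝ => LChi4 s := differentiable_LChi4.continuous.comp continuous_ofReal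
    simpa using (this.tendsto 1).mono_left nhdsWithin_le_nhds
  have h2 : Tendsto (fun s : ℝ => ∑' m : ℕ, (1 / (4 * m + 1 : ℝ) ^ s - 1 / (4 * m + 3 : ℝ) ^ s))
      (𝓝[>] 1) (𝓝 (∑' m : ℕ, (1 / (4 * m + 1) - 1 / (4 * m + 3) : ℝ))) := by
    refine tendsto_tsum_of_dominated_convergence
      (bound := fun m : ℕ => 2 * (1 / (4 * m + 1) - 1 / (4 * m + 3) : ℝ))
      (tsum_leibniz_pairs.summable.mul_left 2) ?_ ?_
    · intro m
      refine Tendsto.mono_left ?_ nhdsWithin_le_nhds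
      have : ContinuousAt (fun s : ℝ => (1 / (4 * m + 1 : ℝ) ^ s - 1 / (4 * m + 3 : ℝ) ^ s)) 1 := by
        have a1 : (4 * m + 1 : ℝ) ≠ 0 := by positivity
        have a3 : (4 * m + 3 : ℝ) ≠ 0 := by positivity
        refine ContinuousAt.sub ?_ ?_
        · exact continuousAt_const.div (Real.continuousAt_const_rpow a1) (by simp [a1])
        · exact continuousAt_const.div (Real.continuousAt_const_rpow a3) (by simp [a3])
      simpa [ContinuousAt] using this
    · filter_upwards [Ioc_mem_nhdsGT (one_lt_two (α := ℝ))] with s hs m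
      obtain ⟨hs1, hs2⟩ := hs
      set x : ℝ := 4 * m + 1 with hx
      set y : ℝ := 4 * m + 3 with hy
      have hx1 : 1 ≤ x := by rw [hx]; linarith [(Nat.cast_nonneg m : (0 : ℝ) ≤ m)]
      have hxy : y = x + 2 := by rw [hx, hy]; ring
      have hx0 : 0 < x := by linarith
      have hy0 : 0 < y := by linarith
      -- Bernoulli's inequality, with x / y = 1 - 2 / y. Combined with s ≤ 2 and x ≤ x ^ s it bounds
      -- each pair by twice its value at s = 1.
      have hB : 1 - s * (2 / y) ≤ (x / y) ^ s := by
        have := one_add_mul_self_le_rpow_one_add (s := -(2 / y)) (p := s) (by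
          rw [neg_le_neg_iff, div_le_one hy0]; linarith) hs1.le
        rw [show 1 + -(2 / y) = x / y by field_simp; linarith] at this
        linarith
      have hle : x ^ s ≤ y ^ s := Real.rpow_le_rpow hx0.le (by linarith) (by linarith)
      have hxs : 0 < x ^ s := Real.rpow_pos_of_pos hx0 s
      have hys : 0 < y ^ s := Real.rpow_pos_of_pos hy0 s
      have hxx : x ≤ x ^ s := by
        simpa using Real.rpow_le_rpow_of_exponent_le hx1 hs1.le
      rw [Real.norm_of_nonneg (sub_nonneg.mpr (one_div_le_one_div_of_le hxs hle))]
      have e1 : 1 / x ^ s - 1 / y ^ s = 1 / x ^ s * (1 - (x / y) ^ s) := by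
        rw [Real.div_rpow hx0.le hy0.le]; field_simp
      have e2 : 2 * (1 / x - 1 / y) = 1 / x * (2 * (2 / y)) := by
        rw [hxy]; field_simp; ring
      rw [e1, e2]
      have hy2 : 0 ≤ 2 / y := by positivity
      refine mul_le_mul (one_div_le_one_div_of_le hx0 hxx) ?_ ?_ (by positivity)
      · nlinarith
      · rw [sub_nonneg]
        exact Real.rpow_le_one (by positivity) (by rw [div_le_one hy0]; linarith) (by linarith)
  rw [tsum_leibniz_pairs.tsum_eq] at h2
  have h3 := (continuous_ofReal.tendsto (Real.pi / 4)).comp h2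
  have h4 := tendsto_nhds_unique (h1.congr' (by
    filter_upwards [self_mem_nhdsWithin] with s hs using LChi4_ofReal hs)) h3
  rw [h4]; push_cast; rfl

theorem completedLChi4_zero : completedLChi4 0 = LChi4 0 := by
  rw [LChi4_eq_div, zero_add, Gammaℝ_one, div_one]

theorem completedLChi4_one : completedLChi4 1 = LChi4 1 / Real.pi := by
  rw [LChi4_eq_div, Gammaℝ_def]
  norm_num
  have : (Real.pi : ℂ) ≠ 0 := by exact_mod_cast Real.pi_ne_zero
  rw [cpow_neg_one]
  field_simp

theorem LChi4_zero : LChi4 0 = 1 / 2 := by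
  have h := completedLChi4_one_sub 1
  rw [sub_self, completedLChi4_zero, completedLChi4_one, LChi4_one,
    show (2 : ℂ) * 1 - 1 = 1 by norm_num, cpow_one] at h
  rw [h]
  have : (Real.pi : ℂ) ≠ 0 := by exact_mod_cast Real.pi_ne_zero
  field_simp
  norm_num

/-! ### The completed product of ζ, L(·, χ₄) and Γ. -/

/-- The entire function `s (s - 1) Γ(s) ζ(s) L(s, χ₄)`. -/
noncomputable def circleXi (s : ℂ) : ℂ :=
  (s * (s - 1) * completedRiemannZeta₀ s + 1) * completedLChi4 s * (2 * Real.pi : ℂ) ^ s / 2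

theorem two_pi_ne_zero' : (2 * Real.pi : ℂ) ≠ 0 := by
  exact_mod_cast mul_ne_zero two_ne_zero Real.pi_ne_zero

theorem differentiable_circleXi : Differentiable ℂ circleXi := by
  have h0 := differentiable_completedZeta₀
  have h1 := differentiable_completedLChi4
  have h2 : Differentiable ℂ fun s : ℂ => (2 * Real.pi : ℂ) ^ s :=
    differentiable_id.const_cpow (Or.inl two_pi_ne_zero')
  unfold circleXi
  fun_prop

theorem circleXi_one_sub (s : ℂ) :
    circleXi (1 - s) = (Real.pi : ℂ) ^ (1 - 2 * s) * circleXi s := by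
  have hpi : (Real.pi : ℂ) ≠ 0 := by exact_mod_cast Real.pi_ne_zero
  have hm : ∀ z : ℂ, (2 * Real.pi : ℂ) ^ z = (2 : ℂ) ^ z * (Real.pi : ℂ) ^ z := by
    intro z
    have := mul_cpow_ofReal_nonneg (a := 2) (b := Real.pi) (by norm_num) Real.pi_pos.le z
    simpa using this
  unfold circleXi
  rw [completedRiemannZeta₀_one_sub, completedLChi4_one_sub, hm, hm]
  have e1 : (2 : ℂ) ^ (2 * s - 1) * (2 : ℂ) ^ (1 - s) = (2 : ℂ) ^ s := by
    rw [← cpow_add _ _ two_ne_zero]; congr 1; ring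
  have e2 : (Real.pi : ℂ) ^ (1 - 2 * s) * (Real.pi : ℂ) ^ s = (Real.pi : ℂ) ^ (1 - s) := by
    rw [← cpow_add _ _ hpi]; congr 1; ring
  rw [← e2, ← e1]
  ring

theorem mul_completedRiemannZeta {s : ℂ} (h0 : s ≠ 0) (h1 : s ≠ 1) :
    s * (s - 1) * completedRiemannZeta s = s * (s - 1) * completedRiemannZeta₀ s + 1 := by
  have h1' : 1 - s ≠ 0 := sub_ne_zero.mpr h1.symm
  rw [completedRiemannZeta_eq]
  field_simp
  ring

/-- By duplication Γ(s) is Γℝ(s) Γℝ(s + 1) (2π)^s / 2, which absorbs the Gamma factors of ζ (even)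
and of χ₄ (odd). The excluded points are the poles of Γ and of ζ, where Lean's values do not follow
the analytic continuation. -/
theorem circleXi_eq {s : ℂ} (hs : ∀ n : ℕ, s ≠ -n) (h1 : s ≠ 1) :
    circleXi s = s * (s - 1) * (Gamma s * riemannZeta s * LChi4 s) := by
  have h0 : s ≠ 0 := by simpa using hs 0
  have g0 : Gammaℝ s ≠ 0 := by
    rw [Ne, Gammaℝ_eq_zero_iff]
    rintro ⟨n, hn⟩
    exact hs (2 * n) (by rw [hn]; push_cast; ring)
  have g1 : Gammaℝ (s + 1) ≠ 0 := by
    rw [Ne, Gammaℝ_eq_zero_iff]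
    rintro ⟨n, hn⟩
    exact hs (2 * n + 1) (by rw [eq_sub_of_add_eq hn]; push_cast; ring)
  rw [riemannZeta_def_of_ne_zero h0, LChi4_eq_div, circleXi, ← mul_completedRiemannZeta h0 h1]
  have hG : Gamma s = Gammaℝ s * Gammaℝ (s + 1) * (2 * Real.pi : ℂ) ^ s / 2 := by
    rw [Gammaℝ_mul_Gammaℝ_add_one, Gammaℂ_def, cpow_neg]
    have : (2 * Real.pi : ℂ) ^ s ≠ 0 := by simp [cpow_eq_zero_iff]
    field_simp
  rw [hG]
  field_simp

theorem circleXi_zero : circleXi 0 = LChi4 0 / 2 := by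
  simp [circleXi, completedLChi4_zero]

theorem circleXi_one : circleXi 1 = LChi4 1 := by
  have hpi : (Real.pi : ℂ) ≠ 0 := by exact_mod_cast Real.pi_ne_zero
  simp only [circleXi, completedLChi4_one, sub_self, mul_zero, zero_mul, zero_add, one_mul, cpow_one]
  field_simp

theorem xiZeta_mul_xiChi4 (s : ℂ) :
    xiZeta s * xiChi4 s = 2 * (Real.pi : ℂ) ^ (-s) * (Gamma s * riemannZeta s * LChi4 s) := by
  have hm : ∀ z : ℂ, (2 * Real.pi : ℂ) ^ z = (2 : ℂ) ^ z * (Real.pi : ℂ) ^ z := by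
    intro z
    have := mul_cpow_ofReal_nonneg (a := 2) (b := Real.pi) (by norm_num) Real.pi_pos.le z
    simpa using this
  have h : xiZeta s * xiChi4 s =
      (Gammaℝ s * Gammaℝ (s + 1)) * (2 : ℂ) ^ s * (riemannZeta s * LChi4 s) := by
    rw [xiZeta, xiChi4, Gammaℝ_def, Gammaℝ_def]; ring
  rw [h, Gammaℝ_mul_Gammaℝ_add_one, Gammaℂ_def, hm, cpow_neg 2]
  have : (2 : ℂ) ^ s ≠ 0 := by simp [cpow_eq_zero_iff]
  field_simp

/-! ### The Dirichlet series of ζ(s) L(s, χ₄) in the half-plane Re s > 1. -/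

theorem LSeriesHasSum_chi4DivisorSum {s : ℂ} (hs : 1 < s.re) :
    LSeriesHasSum (fun n => (chi4DivisorSum n : ℂ)) s (riemannZeta s * LChi4 s) := by
  have h1 := LSeriesHasSum_one hs
  have h2 := (DirichletCharacter.LSeriesSummable_of_one_lt_re chi4 hs).LSeriesHasSum
  rw [← DirichletCharacter.LFunction_eq_LSeries _ hs, ← LChi4_eq_LFunction] at h2
  have h := h1.convolution h2
  have : LSeries.convolution 1 (fun n : ℕ => chi4 n) = fun n => (chi4DivisorSum n : ℂ) := by
    rw [LSeries.convolution_def]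
    ext n
    rw [chi4DivisorSum, ← Nat.map_div_left_divisors, Finset.sum_map, Int.cast_sum]
    refine Finset.sum_congr rfl fun d _ => ?_
    simp only [Pi.one_apply, one_mul, chi4_apply]
    rfl
  rwa [this] at h

theorem hasSum_chi4DivisorSum {s : ℂ} (hs : 1 < s.re) :
    HasSum (fun n : ℕ => (chi4DivisorSum (n + 1) : ℂ) * (((n + 1 : ℕ) : ℝ) : ℂ) ^ (-s))
      (riemannZeta s * LChi4 s) := by
  have h := LSeriesHasSum_chi4DivisorSum hs
  unfold LSeriesHasSum at h
  rw [← hasSum_nat_add_iff' 1] at h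
  simp only [Finset.range_one, Finset.sum_singleton, LSeries.term_zero, sub_zero] at h
  refine h.congr_fun fun n => ?_
  rw [LSeries.term_of_ne_zero n.succ_ne_zero, cpow_neg, div_eq_mul_inv]
  push_cast
  rfl

theorem summable_abs_chi4DivisorSum {b : ℝ} (hb : 1 < b) :
    Summable (fun n : ℕ => |(chi4DivisorSum (n + 1) : ℝ)| * ((n + 1 : ℕ) : ℝ) ^ (-b)) := by
  have := (hasSum_chi4DivisorSum (s := (b : ℂ)) (by simpa using hb)).summable.norm
  refine this.congr fun n => ?_
  rw [norm_mul, norm_cpow_eq_rpow_re_of_pos (by positivity), norm_intCast]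
  simp

theorem exists_norm_zeta_mul_LChi4_le {b : ℝ} (hb : 1 < b) :
    ∃ C : ℝ, 0 ≤ C ∧ ∀ s : ℂ, s.re = b → ‖riemannZeta s * LChi4 s‖ ≤ C := by
  refine ⟨∑' n : ℕ, |(chi4DivisorSum (n + 1) : ℝ)| * ((n + 1 : ℕ) : ℝ) ^ (-b),
    tsum_nonneg fun n => by positivity, fun s hs => ?_⟩
  rw [← (hasSum_chi4DivisorSum (by rw [hs]; exact hb)).tsum_eq]
  refine tsum_of_norm_bounded (summable_abs_chi4DivisorSum hb).hasSum fun n => le_of_eq ?_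
  rw [norm_mul, norm_cpow_eq_rpow_re_of_pos (by positivity), norm_intCast, neg_re, hs]

/-! ### Growth on vertical strips: Mellin transforms, completed L-functions, Γ. -/

/-- For a ≤ Re s ≤ b, |t^{s-1}| is at most t^{a-1} + t^{b-1}, so the two edges dominate the whole
strip. -/
theorem exists_norm_mellin_le {f : ℝ → ℂ} {a b : ℝ} (ha : MellinConvergent f a)
    (hb : MellinConvergent f b) :
    ∃ C : ℝ, 0 ≤ C ∧ ∀ s : ℂ, a ≤ s.re → s.re ≤ b → ‖mellin f s‖ ≤ C := by
  refine ⟨∫ t : ℝ in Set.Ioi 0, (‖(t : ℂ) ^ ((a : ℂ) - 1) • f t‖ + ‖(t : ℂ) ^ ((b : ℂ) - 1) • f t‖),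
    integral_nonneg fun t => by positivity, fun s h1 h2 => ?_⟩
  refine norm_integral_le_of_norm_le (ha.norm.add hb.norm) ?_
  filter_upwards [self_mem_ae_restrict measurableSet_Ioi] with t ht
  have ht' : (0 : ℝ) < t := ht
  rw [norm_smul, norm_smul, norm_smul, ← add_mul]
  refine mul_le_mul_of_nonneg_right ?_ (norm_nonneg _)
  simp only [norm_cpow_eq_rpow_re_of_pos ht', sub_re, one_re, ofReal_re]
  rcases le_total 1 t with h | h
  · have := Real.rpow_le_rpow_of_exponent_le h (sub_le_sub_right h2 1)
    have := Real.rpow_nonneg ht'.le (a - 1)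
    linarith
  · have := Real.rpow_le_rpow_of_exponent_ge ht' h (sub_le_sub_right h1 1)
    have := Real.rpow_nonneg ht'.le (b - 1)
    linarith

/-- The function is half the Mellin transform, at s / 2, of a kernel decaying rapidly enough at both
0 and ∞ for the transform to converge everywhere. -/
theorem exists_norm_completedRiemannZeta₀_le (a b : ℝ) :
    ∃ C : ℝ, 0 ≤ C ∧ ∀ s : ℂ, a ≤ s.re → s.re ≤ b → ‖completedRiemannZeta₀ s‖ ≤ C := by
  have hP := (HurwitzZeta.hurwitzEvenFEPair 0).isStrongFEPair_toStrongFEPair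
  obtain ⟨C, hC, h⟩ := exists_norm_mellin_le (hP.hasMellin ((a / 2 : ℝ) : ℂ)).1
    (hP.hasMellin ((b / 2 : ℝ) : ℂ)).1
  refine ⟨C, hC, fun s h1 h2 => ?_⟩
  have h3 := h (s / 2) (by simp; linarith) (by simp; linarith)
  change ‖mellin (HurwitzZeta.hurwitzEvenFEPair 0).toStrongFEPair.f (s / 2) / 2‖ ≤ C
  rw [norm_div]
  norm_num
  linarith [norm_nonneg (mellin (HurwitzZeta.hurwitzEvenFEPair 0).toStrongFEPair.f (s / 2))]

theorem exists_norm_completedHurwitzZetaOdd_le (x : UnitAddCircle) (a b : ℝ) :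
    ∃ C : ℝ, 0 ≤ C ∧ ∀ s : ℂ, a ≤ s.re → s.re ≤ b →
      ‖HurwitzZeta.completedHurwitzZetaOdd x s‖ ≤ C := by
  have hP := HurwitzZeta.isStrong_hurwitzOddFEPair x
  obtain ⟨C, hC, h⟩ := exists_norm_mellin_le (hP.hasMellin (((a + 1) / 2 : ℝ) : ℂ)).1
    (hP.hasMellin (((b + 1) / 2 : ℝ) : ℂ)).1
  refine ⟨C, hC, fun s h1 h2 => ?_⟩
  have h3 := h ((s + 1) / 2) (by simp; linarith) (by simp; linarith)
  rw [HurwitzZeta.completedHurwitzZetaOdd, hP.Λ_eq, norm_div]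
  norm_num
  linarith [norm_nonneg (mellin (HurwitzZeta.hurwitzOddFEPair x).f ((s + 1) / 2))]

theorem rpow_le_add_of_mem_Icc {x a b σ : ℝ} (hx : 0 < x) (h1 : a ≤ σ) (h2 : σ ≤ b) :
    x ^ σ ≤ x ^ a + x ^ b := by
  rcases le_total 1 x with h | h
  · have := Real.rpow_le_rpow_of_exponent_le h h2
    have := Real.rpow_nonneg hx.le a
    linarith
  · have := Real.rpow_le_rpow_of_exponent_ge hx h h1
    have := Real.rpow_nonneg hx.le b
    linarith

theorem exists_norm_completedLChi4_le (a b : ℝ) :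
    ∃ C : ℝ, 0 ≤ C ∧ ∀ s : ℂ, a ≤ s.re → s.re ≤ b → ‖completedLChi4 s‖ ≤ C := by
  choose C hC h using fun j : ZMod 4 =>
    exists_norm_completedHurwitzZetaOdd_le (ZMod.toAddCircle j) a b
  refine ⟨(4 ^ (-a) + 4 ^ (-b)) * ∑ j : ZMod 4, ‖chi4 j‖ * C j,
    mul_nonneg (by positivity) (Finset.sum_nonneg fun j _ => mul_nonneg (norm_nonneg _) (hC j)),
    fun s h1 h2 => ?_⟩
  change ‖ZMod.completedLFunction (chi4 : ZMod 4 → ℂ) s‖ ≤ _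
  rw [ZMod.completedLFunction_def_odd chi4_odd.to_fun, norm_mul]
  refine mul_le_mul ?_ ?_ (norm_nonneg _) (by positivity)
  · have := norm_cpow_eq_rpow_re_of_pos (x := 4) (by norm_num) (-s)
    push_cast at this ⊢
    rw [this, neg_re, add_comm]
    exact rpow_le_add_of_mem_Icc (by norm_num) (by linarith) (by linarith)
  · refine (norm_sum_le _ _).trans (Finset.sum_le_sum fun j _ => ?_)
    rw [norm_mul]
    exact mul_le_mul_of_nonneg_left (h j s h1 h2) (norm_nonneg _)

theorem exists_norm_circleXi_le (a b : ℝ) :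
    ∃ C : ℝ, 0 ≤ C ∧ ∀ s : ℂ, a ≤ s.re → s.re ≤ b → ‖circleXi s‖ ≤ C * (‖s‖ * ‖s - 1‖ + 1) := by
  obtain ⟨C₁, h1, H1⟩ := exists_norm_completedRiemannZeta₀_le a b
  obtain ⟨C₂, h2, H2⟩ := exists_norm_completedLChi4_le a b
  refine ⟨(C₁ + 1) * C₂ * ((2 * Real.pi) ^ a + (2 * Real.pi) ^ b), by positivity, fun s ha hb => ?_⟩
  have h2pi : 0 < 2 * Real.pi := by positivity
  have e1 : ‖(2 * Real.pi : ℂ) ^ s‖ ≤ (2 * Real.pi) ^ a + (2 * Real.pi) ^ b := by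
    have := norm_cpow_eq_rpow_re_of_pos h2pi s
    push_cast at this
    rw [this]
    exact rpow_le_add_of_mem_Icc h2pi ha hb
  have e2 : ‖s * (s - 1) * completedRiemannZeta₀ s + 1‖ ≤ (C₁ + 1) * (‖s‖ * ‖s - 1‖ + 1) := by
    refine (norm_add_le _ _).trans ?_
    rw [norm_mul, norm_mul, norm_one]
    have := mul_le_mul_of_nonneg_left (H1 s ha hb) (by positivity : 0 ≤ ‖s‖ * ‖s - 1‖)
    have : 0 ≤ ‖s‖ * ‖s - 1‖ := by positivity
    nlinarith
  unfold circleXi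
  rw [norm_div, norm_mul, norm_mul]
  have hn2 : ‖(2 : ℂ)‖ = 2 := by norm_num
  rw [hn2]
  calc _ ≤ ‖s * (s - 1) * completedRiemannZeta₀ s + 1‖ * ‖completedLChi4 s‖ *
        ‖(2 * Real.pi : ℂ) ^ s‖ := by
        apply div_le_self (by positivity) (by norm_num)
    _ ≤ ((C₁ + 1) * (‖s‖ * ‖s - 1‖ + 1)) * C₂ * ((2 * Real.pi) ^ a + (2 * Real.pi) ^ b) := by
        gcongr
        exact H2 s ha hb
    _ = _ := by ring

theorem exists_norm_Gamma_le_of_re_pos {a : ℝ} (ha : 0 < a) (b : ℝ) :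
    ∃ C : ℝ, 0 ≤ C ∧ ∀ s : ℂ, a ≤ s.re → s.re ≤ b → ‖Gamma s‖ ≤ C := by
  have conv : ∀ x : ℝ, 0 < x → MellinConvergent (fun t : ℝ => (Real.exp (-t) : ℂ)) x := by
    intro x hx
    have := Complex.GammaIntegral_convergent (s := (x : ℂ)) (by simpa using hx)
    simpa [MellinConvergent, mul_comm] using this
  rcases le_or_gt a b with hab | hab
  · obtain ⟨C, hC, h⟩ := exists_norm_mellin_le (conv a ha) (conv b (ha.trans_le hab))
    refine ⟨C, hC, fun s h1 h2 => ?_⟩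
    rw [Gamma_eq_integral (ha.trans_le h1), GammaIntegral_eq_mellin]
    exact h s h1 h2
  · exact ⟨0, le_rfl, fun s h1 h2 => by linarith⟩

/-- Every factor s + k in the recurrence for Γ has norm at least |Im s| ≥ 1. -/
theorem norm_Gamma_le_norm_Gamma_add_nat {s : ℂ} (hs : 1 ≤ |s.im|) (m : ℕ) :
    ‖Gamma s‖ ≤ ‖Gamma (s + m)‖ := by
  induction m with
  | zero => simp
  | succ m ih =>
    refine ih.trans ?_
    have h1 : 1 ≤ ‖s + m‖ := by
      refine hs.trans ?_
      simpa using abs_im_le_norm (s + m)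
    rw [Nat.cast_add_one, ← add_assoc, Gamma_add_one _ (norm_pos_iff.mp (by linarith)), norm_mul]
    exact le_mul_of_one_le_left (norm_nonneg _) h1

theorem norm_sin_le_exp (z : ℂ) : ‖Complex.sin z‖ ≤ Real.exp |z.im| := by
  rw [Complex.sin, norm_div, norm_mul, norm_I, mul_one]
  have h1 : ‖exp (-z * I)‖ ≤ Real.exp |z.im| := by
    rw [norm_exp]; simpa using le_abs_self z.im
  have h2 : ‖exp (z * I)‖ ≤ Real.exp |z.im| := by
    rw [norm_exp]; simpa using neg_le_abs z.im
  have := norm_sub_le (exp (-z * I)) (exp (z * I))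
  have hn2 : ‖(2 : ℂ)‖ = 2 := by norm_num
  rw [hn2]
  linarith

/-- Reflection writes 1/Γ(s) as Γ(1 - s) sin(πs) / π. The exponential bound is crude, but it only
feeds the a priori growth condition of Phragmén–Lindelöf. -/
theorem exists_norm_inv_Gamma_le (a b : ℝ) :
    ∃ C : ℝ, 0 ≤ C ∧ ∀ s : ℂ, a ≤ s.re → s.re ≤ b → 1 ≤ |s.im| →
      ‖(Gamma s)⁻¹‖ ≤ C * Real.exp (Real.pi * |s.im|) := by
  obtain ⟨m, hm⟩ := exists_nat_gt b
  obtain ⟨C, hC, h⟩ := exists_norm_Gamma_le_of_re_pos one_pos (1 - a + m)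
  refine ⟨C, hC, fun s h1 h2 h3 => ?_⟩
  have hpi : (Real.pi : ℂ) ≠ 0 := by exact_mod_cast Real.pi_ne_zero
  have him : s.im ≠ 0 := by
    intro h0; rw [h0] at h3; norm_num at h3
  have hG : Gamma s ≠ 0 := Gamma_ne_zero fun k hk => him (by rw [hk]; simp)
  have hG' : Gamma (1 - s) ≠ 0 := Gamma_ne_zero fun k hk => him (by
    have := congrArg Complex.im hk; simpa using this)
  have hr := Gamma_mul_Gamma_one_sub s
  have hsin : Complex.sin (Real.pi * s) ≠ 0 := by
    intro h0
    rw [h0, div_zero] at hr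
    exact mul_ne_zero hG hG' hr
  have e : (Gamma s)⁻¹ = Gamma (1 - s) * Complex.sin (Real.pi * s) / Real.pi := by
    rw [eq_div_iff hsin] at hr
    rw [eq_div_iff hpi, inv_mul_eq_iff_eq_mul₀ hG, ← mul_assoc, hr]
  have hpi1 : ‖(Real.pi : ℂ)‖ = Real.pi := by simp [Real.pi_pos.le]
  rw [e, norm_div, norm_mul, hpi1]
  have e1 : ‖Gamma (1 - s)‖ ≤ C :=
    (norm_Gamma_le_norm_Gamma_add_nat (by simpa using h3) m).trans
      (h _ (by simp; linarith) (by simp; linarith))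
  have e2 : ‖Complex.sin (Real.pi * s)‖ ≤ Real.exp (Real.pi * |s.im|) := by
    refine (norm_sin_le_exp _).trans (le_of_eq ?_)
    congr 1
    simp [abs_mul, Real.pi_pos.le]
  calc _ ≤ ‖Gamma (1 - s)‖ * ‖Complex.sin (Real.pi * s)‖ :=
        div_le_self (by positivity) (by linarith [Real.pi_gt_three])
    _ ≤ _ := mul_le_mul e1 e2 (norm_nonneg _) hC

/-- From Γ(s)Γ(d) = B(s, d)Γ(s + d), where |B(s, d)| is bounded by an integral depending on Re s and
d alone. This replaces Stirling's formula when comparing Gamma values on parallel lines. -/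
theorem exists_norm_Gamma_le_norm_Gamma_add {x d : ℝ} (hx : 0 < x) (hd : 0 < d) :
    ∃ C : ℝ, 0 ≤ C ∧ ∀ s : ℂ, s.re = x → ‖Gamma s‖ ≤ C * ‖Gamma (s + d)‖ := by
  have hd' : (0 : ℝ) < ((d : ℝ) : ℂ).re := by simpa using hd
  have hGd : 0 < ‖Gamma (d : ℂ)‖ := norm_pos_iff.mpr (Gamma_ne_zero_of_re_pos hd')
  refine ⟨(∫ t in (0 : ℝ)..1, ‖(t : ℂ) ^ ((x : ℂ) - 1) * (1 - t) ^ ((d : ℂ) - 1)‖) / ‖Gamma (d : ℂ)‖,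
    div_nonneg (intervalIntegral.integral_nonneg zero_le_one fun t _ => norm_nonneg _) hGd.le,
    fun s hs => ?_⟩
  have hB : ‖betaIntegral s d‖ ≤
      ∫ t in (0 : ℝ)..1, ‖(t : ℂ) ^ ((x : ℂ) - 1) * (1 - t) ^ ((d : ℂ) - 1)‖ := by
    rw [betaIntegral]
    refine (intervalIntegral.norm_integral_le_integral_norm zero_le_one).trans (le_of_eq ?_)
    refine intervalIntegral.integral_congr_ae (ae_of_all _ fun t ht => ?_)
    rw [Set.uIoc_of_le zero_le_one] at ht
    simp only [norm_mul, norm_cpow_eq_rpow_re_of_pos ht.1, sub_re, hs, ofReal_re]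
  have h := Gamma_mul_Gamma_eq_betaIntegral (s := s) (t := d) (by rw [hs]; exact hx) hd'
  have h' := congrArg norm h
  rw [norm_mul, norm_mul] at h'
  rw [div_mul_eq_mul_div, le_div_iff₀ hGd, h', mul_comm]
  exact mul_le_mul_of_nonneg_right hB (norm_nonneg _)

/-! ### Mellin transforms of derivatives and the entire function F^{(s)}(0). -/

/-- The `n`-th derivative of `F`, reflected to the half-line `[0, ∞[`. -/
noncomputable def reflDeriv (F : ℝ → ℂ) (n : ℕ) (u : ℝ) : ℂ :=
  iteratedDerivWithin n F (Set.Iic 0) (-u)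

theorem reflDeriv_zero (F : ℝ → ℂ) : reflDeriv F 0 = fun u => F (-u) := by
  ext u; simp [reflDeriv]

namespace IsSchwartzHalfLine

variable {F : ℝ → ℂ}

theorem continuousOn_reflDeriv (hF : IsSchwartzHalfLine F) (n : ℕ) :
    ContinuousOn (reflDeriv F n) (Set.Ici 0) := by
  have h := hF.smooth.continuousOn_iteratedDerivWithin (m := n) (by exact_mod_cast le_top)
    (uniqueDiffOn_Iic 0)
  exact h.comp continuous_neg.continuousOn fun u hu => by simpa using hu

theorem hasDerivAt_reflDeriv (hF : IsSchwartzHalfLine F) (n : ℕ) {u : ℝ} (hu : 0 < u) :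
    HasDerivAt (reflDeriv F n) (-reflDeriv F (n + 1) u) u := by
  have h := hF.smooth.differentiableOn_iteratedDerivWithin (m := n)
    (by exact_mod_cast ENat.natCast_lt_top n) (uniqueDiffOn_Iic 0)
  have h1 := (h (-u) (by simpa using hu.le)).hasDerivWithinAt
  rw [← iteratedDerivWithin_succ] at h1
  have h2 := h1.hasDerivAt (Iic_mem_nhds (by linarith))
  have h3 := h2.scomp u (hasDerivAt_neg u)
  convert! h3 using 1
  simp [reflDeriv]

theorem reflDeriv_isBigO_atTop (hF : IsSchwartzHalfLine F) (n : ℕ) (a : ℝ) :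
    reflDeriv F n =O[atTop] fun u : ℝ => u ^ (-a) := by
  obtain ⟨m, hm⟩ := exists_nat_ge a
  have h := ((hF.decay m n).comp tendsto_neg_atTop_atBot).isBigO_one ℝ
  have h1 : reflDeriv F n =O[atTop] fun u : ℝ => u ^ (-(m : ℝ)) := by
    have h2 := (Asymptotics.isBigO_refl (fun u : ℝ => u ^ (-(m : ℝ))) atTop).smul h
    refine (h2.congr' ?_ ?_)
    · filter_upwards [eventually_gt_atTop 0] with u hu
      have : (u ^ m : ℝ) ≠ 0 := by positivity
      simp only [Function.comp, abs_neg, abs_of_pos hu, reflDeriv, real_smul, ← mul_assoc]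
      rw [Real.rpow_neg hu.le, Real.rpow_natCast, ← ofReal_mul, inv_mul_cancel₀ this]
      simp
    · exact Eventually.of_forall fun u => by simp
  refine h1.trans ?_
  refine Asymptotics.IsBigO.of_bound 1 ?_
  filter_upwards [eventually_ge_atTop 1] with u hu
  have hu0 : 0 ≤ u := by linarith
  rw [one_mul, Real.norm_of_nonneg (Real.rpow_nonneg hu0 _),
    Real.norm_of_nonneg (Real.rpow_nonneg hu0 _)]
  exact Real.rpow_le_rpow_of_exponent_le hu (by linarith)

theorem tendsto_reflDeriv_zero (hF : IsSchwartzHalfLine F) (n : ℕ) :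
    Tendsto (reflDeriv F n) (𝓝[>] 0) (𝓝 (reflDeriv F n 0)) :=
  ((hF.continuousOn_reflDeriv n) 0 Set.self_mem_Ici).mono_left
    (nhdsWithin_mono _ Set.Ioi_subset_Ici_self)

theorem reflDeriv_isBigO_zero (hF : IsSchwartzHalfLine F) (n : ℕ) :
    reflDeriv F n =O[𝓝[>] 0] fun u : ℝ => u ^ (-(0 : ℝ)) := by
  simpa using (hF.tendsto_reflDeriv_zero n).isBigO_one ℝ

theorem locallyIntegrableOn_reflDeriv (hF : IsSchwartzHalfLine F) (n : ℕ) :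
    LocallyIntegrableOn (reflDeriv F n) (Set.Ioi 0) :=
  ((hF.continuousOn_reflDeriv n).mono Set.Ioi_subset_Ici_self).locallyIntegrableOn measurableSet_Ioi

theorem mellinConvergent (hF : IsSchwartzHalfLine F) (n : ℕ) {s : ℂ} (hs : 0 < s.re) :
    MellinConvergent (reflDeriv F n) s :=
  mellinConvergent_of_isBigO_rpow (hF.locallyIntegrableOn_reflDeriv n)
    (hF.reflDeriv_isBigO_atTop n (s.re + 1)) (by linarith) (hF.reflDeriv_isBigO_zero n) hs

theorem differentiableAt_mellin (hF : IsSchwartzHalfLine F) (n : ℕ) {s : ℂ} (hs : 0 < s.re) :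
    DifferentiableAt ℂ (mellin (reflDeriv F n)) s :=
  mellin_differentiableAt_of_isBigO_rpow (hF.locallyIntegrableOn_reflDeriv n)
    (hF.reflDeriv_isBigO_atTop n (s.re + 1)) (by linarith) (hF.reflDeriv_isBigO_zero n) hs

theorem exists_norm_mellin_le (hF : IsSchwartzHalfLine F) (n : ℕ) {a b : ℝ} (ha : 0 < a)
    (hb : 0 < b) : ∃ C : ℝ, 0 ≤ C ∧ ∀ s : ℂ, a ≤ s.re → s.re ≤ b → ‖mellin (reflDeriv F n) s‖ ≤ C :=
  _root_.exists_norm_mellin_le (hF.mellinConvergent n (by simpa using ha))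
    (hF.mellinConvergent n (by simpa using hb))

theorem tendsto_cpow_mul_reflDeriv_zero (hF : IsSchwartzHalfLine F) (n : ℕ) {s : ℂ}
    (hs : 0 < s.re) : Tendsto (fun u : ℝ => (u : ℂ) ^ s * reflDeriv F n u) (𝓝[>] 0) (𝓝 0) := by
  have h1 : Tendsto (fun u : ℝ => (u : ℂ) ^ s) (𝓝[>] 0) (𝓝 0) := by
    have := (continuous_ofReal_cpow_const hs).tendsto 0
    rw [ofReal_zero, zero_cpow (by rintro rfl; simp at hs)] at this
    exact this.mono_left nhdsWithin_le_nhds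
  simpa using h1.mul (hF.tendsto_reflDeriv_zero n)

theorem tendsto_cpow_mul_reflDeriv_atTop (hF : IsSchwartzHalfLine F) (n : ℕ) (s : ℂ) :
    Tendsto (fun u : ℝ => (u : ℂ) ^ s * reflDeriv F n u) atTop (𝓝 0) := by
  have h2 : (fun u : ℝ => (u : ℂ) ^ s * ((u ^ (-(s.re + 1)) : ℝ) : ℂ)) =O[atTop]
      fun u : ℝ => u ^ (-(1 : ℝ)) := by
    refine Asymptotics.IsBigO.of_bound 1 ?_
    filter_upwards [eventually_gt_atTop 0] with u hu
    rw [norm_mul, norm_cpow_eq_rpow_re_of_pos hu, norm_real,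
      Real.norm_of_nonneg (Real.rpow_nonneg hu.le _), Real.norm_of_nonneg (Real.rpow_nonneg hu.le _),
      ← Real.rpow_add hu, one_mul]
    apply le_of_eq; congr 1; ring
  have h3 : (fun u : ℝ => (u : ℂ) ^ s * reflDeriv F n u) =O[atTop] fun u : ℝ => u ^ (-(1 : ℝ)) := by
    refine Asymptotics.IsBigO.trans ?_ h2
    refine (Asymptotics.isBigO_refl _ _).mul ?_
    refine (hF.reflDeriv_isBigO_atTop n (s.re + 1)).trans ?_
    exact Asymptotics.IsBigO.of_bound 1 (Eventually.of_forall fun u => by simp)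
  exact h3.trans_tendsto (tendsto_rpow_neg_atTop one_pos)

/-- Integration by parts: u^s kills the boundary term at 0 because Re s > 0, rapid decay kills it at
infinity, and the sign of the reflection u ↦ -u cancels the sign of the parts formula. -/
theorem mellin_reflDeriv_succ (hF : IsSchwartzHalfLine F) (n : ℕ) {s : ℂ} (hs : 0 < s.re) :
    mellin (reflDeriv F (n + 1)) (s + 1) = s * mellin (reflDeriv F n) s := by
  have hs0 : s ≠ 0 := by rintro rfl; simp at hs
  have c1 := hF.mellinConvergent (n + 1) (s := s + 1) (by simp; linarith)
  have c0 := hF.mellinConvergent n hs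
  simp only [MellinConvergent, add_sub_cancel_right, smul_eq_mul] at c1 c0
  have h := integral_Ioi_mul_deriv_eq_deriv_mul (a := 0) (a' := (0 : ℂ)) (b' := (0 : ℂ))
    (u := fun u : ℝ => (u : ℂ) ^ s) (v := reflDeriv F n)
    (u' := fun u : ℝ => s * (u : ℂ) ^ (s - 1)) (v' := fun u => -reflDeriv F (n + 1) u)
    (fun u hu => hasDerivAt_ofReal_cpow_const (ne_of_gt hu) hs0)
    (fun u hu => hF.hasDerivAt_reflDeriv n hu)
    (by
      refine c1.neg.congr_fun (fun u _ => ?_) measurableSet_Ioi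
      simp)
    (by
      refine IntegrableOn.congr_fun (c0.const_mul s) (fun u _ => ?_) measurableSet_Ioi
      simp only [Pi.mul_apply, mul_assoc])
    (hF.tendsto_cpow_mul_reflDeriv_zero n hs) (hF.tendsto_cpow_mul_reflDeriv_atTop n s)
  simp only [mul_neg, integral_neg, sub_zero, zero_sub, neg_inj, mul_assoc,
    integral_const_mul] at h
  simpa [mellin] using h

/-- The function `s ↦ (1 / Γ(n - s)) ∫_0^∞ u^{n-s-1} F^{(n)}(-u) du` on `Re s < n`. -/
noncomputable def fracDerivAux (F : ℝ → ℂ) (n : ℕ) (s : ℂ) : ℂ :=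
  mellin (reflDeriv F n) (n - s) / Gamma (n - s)

theorem fracDerivAux_succ (hF : IsSchwartzHalfLine F) (n : ℕ) {s : ℂ} (hs : s.re < n) :
    fracDerivAux F (n + 1) s = fracDerivAux F n s := by
  have h : 0 < ((n : ℂ) - s).re := by simpa using hs
  have h0 : (n : ℂ) - s ≠ 0 := by
    intro h'; rw [h'] at h; simp at h
  rw [fracDerivAux, fracDerivAux, show ((n + 1 : ℕ) : ℂ) - s = (n - s) + 1 by push_cast; ring,
    hF.mellin_reflDeriv_succ n h, Gamma_add_one _ h0, mul_div_mul_left _ _ h0]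

theorem fracDerivAux_add (hF : IsSchwartzHalfLine F) (n k : ℕ) {s : ℂ} (hs : s.re < n) :
    fracDerivAux F (n + k) s = fracDerivAux F n s := by
  induction k with
  | zero => rfl
  | succ k ih =>
    rw [← ih, ← add_assoc]
    exact hF.fracDerivAux_succ (n + k) (hs.trans_le (by push_cast; linarith [k.cast_nonneg (α := ℝ)]))

theorem fracDerivAux_eq (hF : IsSchwartzHalfLine F) {m n : ℕ} {s : ℂ} (hm : s.re < m)
    (hn : s.re < n) : fracDerivAux F m s = fracDerivAux F n s := by
  rcases le_total m n with h | h
  · obtain ⟨k, rfl⟩ := Nat.exists_eq_add_of_le h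
    exact (hF.fracDerivAux_add m k hm).symm
  · obtain ⟨k, rfl⟩ := Nat.exists_eq_add_of_le h
    exact hF.fracDerivAux_add n k hn

theorem differentiableAt_fracDerivAux (hF : IsSchwartzHalfLine F) (n : ℕ) {s : ℂ} (hs : s.re < n) :
    DifferentiableAt ℂ (fracDerivAux F n) s := by
  have h : 0 < ((n : ℂ) - s).re := by simpa using hs
  have hsub : DifferentiableAt ℂ (fun s : ℂ => (n : ℂ) - s) s := by fun_prop
  have h1 := DifferentiableAt.comp s (hF.differentiableAt_mellin n h) hsub
  have h2 := DifferentiableAt.comp s (differentiable_one_div_Gamma ((n : ℂ) - s)) hsub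
  exact h1.mul h2

/-- The n-th formula is holomorphic on Re s < n, and consecutive ones agree by Γ(z + 1) = zΓ(z), so
they glue. At s the index ⌊Re s⌋₊ + 1 is used. -/
theorem exists_fracDeriv (hF : IsSchwartzHalfLine F) :
    ∃ D : ℂ → ℂ, Differentiable ℂ D ∧ ∀ (n : ℕ) (s : ℂ), s.re < n → D s = fracDerivAux F n s := by
  have key : ∀ s : ℂ, s.re < ((⌊s.re⌋₊ + 1 : ℕ) : ℝ) := fun s => by
    push_cast; exact Nat.lt_floor_add_one _
  refine ⟨fun s => fracDerivAux F (⌊s.re⌋₊ + 1) s, fun s => ?_, fun n s hs =>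
    hF.fracDerivAux_eq (key s) hs⟩
  have hd := hF.differentiableAt_fracDerivAux (⌊s.re⌋₊ + 1) (key s)
  refine hd.congr_of_eventuallyEq ?_
  have : {z : ℂ | z.re < ((⌊s.re⌋₊ + 1 : ℕ) : ℝ)} ∈ 𝓝 s :=
    (isOpen_lt continuous_re continuous_const).mem_nhds (key s)
  filter_upwards [this] with z hz using hF.fracDerivAux_eq (key z) hz

theorem fracPrimitive_eq (F : ℝ → ℂ) (s : ℂ) : fracPrimitive F s = fracDerivAux F 0 s := by
  simp only [fracPrimitive, fracDerivAux, mellin, reflDeriv_zero, smul_eq_mul, Nat.cast_zero,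
    zero_sub]
  ring

theorem fracDeriv_spec (hF : IsSchwartzHalfLine F) :
    Differentiable ℂ (fracDeriv F) ∧ ∀ s : ℂ, s.re < 0 → fracDeriv F s = fracPrimitive F s := by
  obtain ⟨D, hD, h⟩ := hF.exists_fracDeriv
  have hex : ∃ D : ℂ → ℂ, Differentiable ℂ D ∧ ∀ s : ℂ, s.re < 0 → D s = fracPrimitive F s :=
    ⟨D, hD, fun s hs => by rw [fracPrimitive_eq]; exact h 0 s (by simpa using hs)⟩
  rw [fracDeriv, dif_pos hex]
  exact hex.choose_spec

/-- `fracDeriv` is an extension picked by choice; the identity theorem near -1 identifies it with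
the glued one. -/
theorem fracDeriv_eq (hF : IsSchwartzHalfLine F) (n : ℕ) {s : ℂ} (hs : s.re < n) :
    fracDeriv F s = mellin (reflDeriv F n) (n - s) / Gamma (n - s) := by
  obtain ⟨D, hD, h⟩ := hF.exists_fracDeriv
  obtain ⟨h1, h2⟩ := hF.fracDeriv_spec
  have hev : fracDeriv F =ᶠ[𝓝 (-1)] D := by
    have : {z : ℂ | z.re < 0} ∈ 𝓝 (-1 : ℂ) :=
      (isOpen_lt continuous_re continuous_const).mem_nhds (by simp)
    filter_upwards [this] with z hz
    rw [h2 z hz, fracPrimitive_eq, h 0 z (by simpa using hz)]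
  have := AnalyticOnNhd.eq_of_eventuallyEq (analyticOnNhd_univ_iff_differentiable.mpr h1)
    (analyticOnNhd_univ_iff_differentiable.mpr hD) hev
  rw [this, h n s hs, fracDerivAux]

theorem fracDeriv_zero (hF : IsSchwartzHalfLine F) : fracDeriv F 0 = F 0 := by
  rw [hF.fracDeriv_eq 1 (by simp)]
  simp only [Nat.cast_one, sub_zero, Gamma_one, div_one, mellin, sub_self, cpow_zero, one_smul]
  have hint := (hF.mellinConvergent 1 (s := 1) (by simp))
  simp only [MellinConvergent, sub_self, cpow_zero, one_smul] at hint
  have h := integral_Ioi_of_hasDerivAt_of_tendsto (a := 0) (m := (0 : ℂ))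
    (((hF.continuousOn_reflDeriv 0) 0 Set.self_mem_Ici))
    (fun u hu => hF.hasDerivAt_reflDeriv 0 hu) hint.neg
    (by simpa using hF.tendsto_cpow_mul_reflDeriv_atTop 0 0)
  rw [integral_neg] at h
  have h0 : reflDeriv F 0 0 = F 0 := by simp [reflDeriv]
  rw [h0] at h
  simpa using h

end IsSchwartzHalfLine

/-! ### Boundedness of `circleW` on vertical strips. -/

/-- The entire function `s (s - 1) Γ(s) ζ(s) L(s, χ₄) F^{(-s)}(0)`. -/
noncomputable def circleW (F : ℝ → ℂ) (s : ℂ) : ℂ := circleXi s * fracDeriv F (-s)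

namespace IsSchwartzHalfLine

variable {F : ℝ → ℂ}

theorem differentiable_circleW (hF : IsSchwartzHalfLine F) : Differentiable ℂ (circleW F) :=
  differentiable_circleXi.mul (hF.fracDeriv_spec.1.comp differentiable_neg)

theorem fracDeriv_neg_eq (hF : IsSchwartzHalfLine F) (n : ℕ) {s : ℂ} (hs : 0 < s.re + n) :
    fracDeriv F (-s) = mellin (reflDeriv F n) (s + n) / Gamma (s + n) := by
  rw [hF.fracDeriv_eq n (by simp; linarith), sub_neg_eq_add, add_comm]

theorem exists_norm_circleW_le_exp (hF : IsSchwartzHalfLine F) (a b : ℝ) :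
    ∃ C : ℝ, 0 ≤ C ∧ ∀ s : ℂ, a ≤ s.re → s.re ≤ b → 1 ≤ |s.im| →
      ‖circleW F s‖ ≤ C * Real.exp ((Real.pi + 2) * |s.im|) := by
  obtain ⟨n, hn⟩ := exists_nat_gt (max (-a) (-b))
  have hna : 0 < a + n := by linarith [le_max_left (-a) (-b)]
  have hnb : 0 < b + n := by linarith [le_max_right (-a) (-b)]
  obtain ⟨C₁, h1, H1⟩ := exists_norm_circleXi_le a b
  obtain ⟨C₂, h2, H2⟩ := hF.exists_norm_mellin_le n hna hnb
  obtain ⟨C₃, h3, H3⟩ := exists_norm_inv_Gamma_le (a + n) (b + n)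
  set R := |a| + |b| + 2 with hR
  have hR2 : 2 ≤ R := by have := abs_nonneg a; have := abs_nonneg b; linarith
  refine ⟨C₁ * (R * R + 1) * C₂ * C₃, by positivity, fun s ha hb hs => ?_⟩
  have hexp : 1 + |s.im| ≤ Real.exp |s.im| := by
    have := Real.add_one_le_exp |s.im|; linarith
  have hre : |s.re| ≤ R - 2 := by
    rw [abs_le]
    constructor
    · linarith [neg_abs_le a, abs_nonneg b]
    · linarith [le_abs_self b, abs_nonneg a]
  have hs1 : ‖s‖ ≤ R * Real.exp |s.im| := by
    have := norm_le_abs_re_add_abs_im s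
    nlinarith [abs_nonneg s.im]
  have hs2 : ‖s - 1‖ ≤ R * Real.exp |s.im| := by
    have h4 := norm_le_abs_re_add_abs_im (s - 1)
    simp only [sub_re, one_re, sub_im, one_im, sub_zero] at h4
    have h5 := abs_sub s.re 1
    rw [abs_one] at h5
    nlinarith [abs_nonneg s.im]
  have hs3 : ‖s‖ * ‖s - 1‖ + 1 ≤ (R * R + 1) * Real.exp (2 * |s.im|) := by
    have h4 := mul_le_mul hs1 hs2 (norm_nonneg _) (by positivity)
    have h5 : Real.exp |s.im| * Real.exp |s.im| = Real.exp (2 * |s.im|) := by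
      rw [← Real.exp_add]; congr 1; ring
    have h6 : 1 ≤ Real.exp (2 * |s.im|) := Real.one_le_exp (by positivity)
    nlinarith
  have e1 := (H1 s ha hb).trans (mul_le_mul_of_nonneg_left hs3 h1)
  have e2 := H2 (s + n) (by simpa using ha) (by simpa using hb)
  have e3 := H3 (s + n) (by simpa using ha) (by simpa using hb) (by simpa using hs)
  simp only [add_im, natCast_im, add_zero] at e3
  rw [circleW, hF.fracDeriv_neg_eq n (by linarith), div_eq_mul_inv, norm_mul, norm_mul]
  calc _ ≤ C₁ * ((R * R + 1) * Real.exp (2 * |s.im|)) *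
        (C₂ * (C₃ * Real.exp (Real.pi * |s.im|))) := by gcongr
    _ = C₁ * (R * R + 1) * C₂ * C₃ * (Real.exp (Real.pi * |s.im|) * Real.exp (2 * |s.im|)) := by ring
    _ = _ := by rw [← Real.exp_add]; congr 2; ring

/-- Using the second derivative of F, the factor s(s-1)Γ(s)/Γ(s+2) collapses to (s-1)/(s+1), of norm
at most 1; the Dirichlet series and the Mellin transform are bounded on the line. -/
theorem exists_norm_circleW_le_right (hF : IsSchwartzHalfLine F) {b : ℝ} (hb : 1 < b) :
    ∃ C : ℝ, ∀ s : ℂ, s.re = b → ‖circleW F s‖ ≤ C := by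
  obtain ⟨C₁, h1, H1⟩ := exists_norm_zeta_mul_LChi4_le hb
  obtain ⟨C₂, h2, H2⟩ := hF.exists_norm_mellin_le 2 (a := b + 2) (b := b + 2) (by linarith)
    (by linarith)
  refine ⟨C₁ * C₂, fun s hs => ?_⟩
  have hspos : 0 < s.re := by linarith
  have e1 := H1 s hs
  have e2 := H2 (s + (2 : ℕ)) (by simp [hs]) (by simp [hs])
  have hs0 : s ≠ 0 := by rintro rfl; simp at hspos
  have hsp : s + 1 ≠ 0 := by
    intro h; have := congrArg Complex.re h; simp at this; linarith
  have hG : Gamma s ≠ 0 := Gamma_ne_zero_of_re_pos hspos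
  have hG2 : Gamma (s + (2 : ℕ)) = (s + 1) * (s * Gamma s) := by
    rw [show s + ((2 : ℕ) : ℂ) = s + 1 + 1 by push_cast; ring, Gamma_add_one _ hsp,
      Gamma_add_one _ hs0]
  have hle : ‖(s - 1) / (s + 1)‖ ≤ 1 := by
    rw [norm_div, div_le_one (norm_pos_iff.mpr hsp)]
    rw [← sq_le_sq₀ (norm_nonneg _) (norm_nonneg _), ← normSq_eq_norm_sq, ← normSq_eq_norm_sq,
      normSq_apply, normSq_apply]
    simp
    nlinarith
  have key : circleW F s = (s - 1) / (s + 1) * (riemannZeta s * LChi4 s) *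
      mellin (reflDeriv F 2) (s + (2 : ℕ)) := by
    rw [circleW, hF.fracDeriv_neg_eq 2 (by push_cast; linarith), hG2, circleXi_eq]
    · field_simp
    · intro n h; rw [h] at hspos; simp at hspos; linarith [n.cast_nonneg (α := ℝ)]
    · rintro rfl; simp at hs; linarith
  rw [key, norm_mul, norm_mul]
  calc _ ≤ 1 * C₁ * C₂ := by gcongr
    _ = _ := by ring

/-- The functional equation moves ζ and L to Re = 1 - a > 1, at the price of Γ(1 - s). Taking m + 2
derivatives of F gives the denominator Γ(s + m + 2): m of them outweigh Γ(1 - s), the last two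
absorb s(s - 1). -/
theorem exists_norm_circleW_le_left (hF : IsSchwartzHalfLine F) {a : ℝ} (ha : a < 0) :
    ∃ C : ℝ, ∀ s : ℂ, s.re = a → ‖circleW F s‖ ≤ C := by
  obtain ⟨m, hm⟩ := exists_nat_gt (2 - 2 * a)
  obtain ⟨C₁, h1, H1⟩ := exists_norm_zeta_mul_LChi4_le (b := 1 - a) (by linarith)
  obtain ⟨C₂, h2, H2⟩ := hF.exists_norm_mellin_le (m + 2) (a := a + (m + 2 : ℕ))
    (b := a + (m + 2 : ℕ)) (by push_cast; linarith) (by push_cast; linarith)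
  -- On Re s = a the conjugate of 1 - s is s + 1 - 2a, and the shift d = m - 1 + 2a carries it
  -- exactly to s + m; m > 2 - 2a makes d positive.
  obtain ⟨C₃, h3, H3⟩ := exists_norm_Gamma_le_norm_Gamma_add (x := 1 - a) (d := m - 1 + 2 * a)
    (by linarith) (by linarith)
  refine ⟨Real.pi ^ (2 * a - 1) * (C₃ * C₁) * C₂, fun s hs => ?_⟩
  have hspos : 0 < (1 - s).re := by simp; linarith
  set z : ℂ := s + m with hz
  have hzre : 2 - a < z.re := by rw [hz]; simp [hs]; linarith
  have hzim : z.im = s.im := by simp [hz]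
  have hz0 : z ≠ 0 := by rintro h; rw [h] at hzre; simp at hzre; linarith
  have hz1 : z + 1 ≠ 0 := by
    intro h; have := congrArg Complex.re h; simp at this; linarith
  have hGz : Gamma z ≠ 0 := Gamma_ne_zero_of_re_pos (by linarith)
  have hG2 : Gamma (s + (m + 2 : ℕ)) = (z + 1) * (z * Gamma z) := by
    rw [show s + ((m + 2 : ℕ) : ℂ) = z + 1 + 1 by rw [hz]; push_cast; ring, Gamma_add_one _ hz1,
      Gamma_add_one _ hz0]
  have hnorm : ∀ v w : ℂ, v.im = w.im → |v.re| ≤ w.re → ‖v‖ ≤ ‖w‖ := by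
    intro v w h1 h2
    rw [← sq_le_sq₀ (norm_nonneg _) (norm_nonneg _), ← normSq_eq_norm_sq, ← normSq_eq_norm_sq,
      normSq_apply, normSq_apply, h1]
    have := abs_le.mp h2
    nlinarith
  have l1 : ‖s / z‖ ≤ 1 := by
    rw [norm_div, div_le_one (norm_pos_iff.mpr hz0)]
    refine hnorm _ _ hzim.symm ?_
    rw [hs, abs_of_neg ha]; linarith
  have l2 : ‖(s - 1) / (z + 1)‖ ≤ 1 := by
    rw [norm_div, div_le_one (norm_pos_iff.mpr hz1)]
    refine hnorm _ _ (by simp [hzim]) ?_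
    simp only [sub_re, add_re, one_re, hs]
    rw [abs_of_neg (by linarith)]; linarith
  have l3 : ‖Gamma (1 - s)‖ ≤ C₃ * ‖Gamma z‖ := by
    have hc : (starRingEnd ℂ) (1 - s) = 1 - 2 * a + s := by
      apply Complex.ext
      · simp [hs]; ring
      · simp
    have h := H3 ((starRingEnd ℂ) (1 - s)) (by simp [hs])
    rw [Gamma_conj, norm_conj, hc] at h
    convert h using 4
    rw [hz]; push_cast; ring
  have l4 : ‖(Real.pi : ℂ) ^ (1 - 2 * (1 - s))‖ = Real.pi ^ (2 * a - 1) := by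
    rw [norm_cpow_eq_rpow_re_of_pos Real.pi_pos]
    congr 1
    simp [hs]; ring
  have e1 := H1 (1 - s) (by simp [hs])
  have e2 := H2 (s + (m + 2 : ℕ)) (by simp [hs]) (by simp [hs])
  have hXi : circleXi s = (Real.pi : ℂ) ^ (1 - 2 * (1 - s)) *
      (s * (s - 1) * (Gamma (1 - s) * (riemannZeta (1 - s) * LChi4 (1 - s)))) := by
    have := circleXi_one_sub (1 - s)
    rw [sub_sub_cancel] at this
    rw [this, circleXi_eq]
    · ring
    · intro n h; rw [h] at hspos; simp at hspos; linarith [n.cast_nonneg (α := ℝ)]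
    · intro h
      have : s = 0 := by linear_combination -h
      rw [this] at hs; simp at hs; linarith
  have key : circleW F s = (Real.pi : ℂ) ^ (1 - 2 * (1 - s)) * ((s / z) * ((s - 1) / (z + 1)) *
      (Gamma (1 - s) / Gamma z) * (riemannZeta (1 - s) * LChi4 (1 - s))) *
      mellin (reflDeriv F (m + 2)) (s + (m + 2 : ℕ)) := by
    rw [circleW, hF.fracDeriv_neg_eq (m + 2) (by rw [hs]; push_cast; linarith), hG2, hXi]
    field_simp
  have l5 : ‖Gamma (1 - s) / Gamma z‖ ≤ C₃ := by
    rw [norm_div, div_le_iff₀ (norm_pos_iff.mpr hGz)]; exact l3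
  rw [key, norm_mul, norm_mul, norm_mul, norm_mul, norm_mul, l4]
  have hpi := Real.rpow_nonneg Real.pi_pos.le (2 * a - 1)
  calc _ ≤ Real.pi ^ (2 * a - 1) * (1 * 1 * C₃ * C₁) * C₂ := by gcongr
    _ = _ := by ring

theorem exists_norm_circleW_le (hF : IsSchwartzHalfLine F) {a b : ℝ} (ha : a < 0) (hb : 1 < b) :
    ∃ C : ℝ, ∀ s : ℂ, a ≤ s.re → s.re ≤ b → ‖circleW F s‖ ≤ C := by
  obtain ⟨C₁, H1⟩ := hF.exists_norm_circleW_le_left ha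
  obtain ⟨C₂, H2⟩ := hF.exists_norm_circleW_le_right hb
  obtain ⟨C₃, h3, H3⟩ := hF.exists_norm_circleW_le_exp a b
  refine ⟨max C₁ C₂, fun s h1 h2 => ?_⟩
  have hba : 0 < b - a := by linarith
  -- Half the critical exponent π / (b - a); any smaller positive exponent would do, since the a
  -- priori growth is only simply exponential.
  set c := Real.pi / (2 * (b - a)) with hc
  have hc0 : 0 < c := div_pos Real.pi_pos (by linarith)
  refine PhragmenLindelof.vertical_strip (a := a) (b := b) hF.differentiable_circleW.diffContOnCl
    ⟨c, ?_, (Real.pi + 2) / c, ?_⟩ (fun z hz => (H1 z hz).trans (le_max_left _ _))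
    (fun z hz => (H2 z hz).trans (le_max_right _ _)) h1 h2
  · exact div_lt_div_of_pos_left Real.pi_pos hba (by linarith)
  · refine Asymptotics.IsBigO.of_bound C₃ ?_
    have hev : ∀ᶠ z : ℂ in comap (abs ∘ Complex.im) atTop, 1 ≤ |z.im| :=
      tendsto_comap.eventually (eventually_ge_atTop (1 : ℝ))
    filter_upwards [hev.filter_mono inf_le_left, mem_inf_of_right (mem_principal_self _)] with z hz hz'
    refine (H3 z hz'.1.le hz'.2.le hz).trans (mul_le_mul_of_nonneg_left ?_ h3)
    rw [Real.norm_of_nonneg (Real.exp_pos _).le, Real.exp_le_exp]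
    have := Real.add_one_le_exp (c * |z.im|)
    rw [div_mul_eq_mul_div, le_div_iff₀ hc0]
    nlinarith [Real.pi_pos]

end IsSchwartzHalfLine

/-! ### Shifting a vertical line across the poles at 0 and 1. -/

/-- A primitive is arctan(y/c) - (i/2) log(c² + y²); over the symmetric interval the logarithms
cancel. The integral converges only in this principal-value sense. -/
theorem tendsto_integral_inv_vertical {c : ℝ} (hc : c ≠ 0) :
    Tendsto (fun T : ℝ => ∫ y in (-T)..T, ((c : ℂ) + y * I)⁻¹) atTop
      (𝓝 (Real.pi * Real.sign c : ℝ)) := by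
  have hne : ∀ y : ℝ, (c : ℂ) + y * I ≠ 0 := fun y h => hc (by simpa using congrArg Complex.re h)
  have hpos : ∀ y : ℝ, 0 < c ^ 2 + y ^ 2 := fun y => by positivity
  have hderiv : ∀ y : ℝ, HasDerivAt (fun y : ℝ => ((Real.arctan (y / c) : ℝ) : ℂ) -
      I / 2 * ((Real.log (c ^ 2 + y ^ 2) : ℝ) : ℂ)) ((c : ℂ) + y * I)⁻¹ y := by
    intro y
    have h1 := (((hasDerivAt_id y).div_const c).arctan).ofReal_comp
    have h2 := (((hasDerivAt_pow 2 y).const_add (c ^ 2)).log (hpos y).ne').ofReal_comp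
    convert! h1.sub (h2.const_mul (I / 2)) using 1
    have h3 : ((c : ℂ) ^ 2 + y ^ 2) ≠ 0 := by exact_mod_cast (hpos y).ne'
    have h4 : (c : ℂ) ≠ 0 := by exact_mod_cast hc
    have h5 : (1 : ℂ) + (y / c) ^ 2 ≠ 0 := by
      have : (1 : ℝ) + (y / c) ^ 2 ≠ 0 := by positivity
      exact_mod_cast this
    have h6 : ((c : ℂ) + y * I) * ((c : ℂ) - y * I) = c ^ 2 + y ^ 2 := by
      linear_combination -(y : ℂ) ^ 2 * I_sq
    have h7 : ((c : ℂ) + y * I)⁻¹ = ((c : ℂ) - y * I) / (c ^ 2 + y ^ 2) := by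
      rw [eq_div_iff h3, ← h6, inv_mul_cancel_left₀ (hne y)]
    have h8 : (1 : ℂ) / (1 + (y / c) ^ 2) * (1 / c) = c / (c ^ 2 + y ^ 2) := by
      have : (1 : ℂ) + (y / c) ^ 2 = (c ^ 2 + y ^ 2) / c ^ 2 := by field_simp
      rw [this]; field_simp
    rw [h7]
    simp only [id]
    push_cast
    rw [h8]
    field_simp
  have hcont : Continuous fun y : ℝ => ((c : ℂ) + y * I)⁻¹ :=
    Continuous.inv₀ (by fun_prop) hne
  have hval : ∀ T : ℝ, ∫ y in (-T)..T, ((c : ℂ) + y * I)⁻¹ = ((2 * Real.arctan (T / c) : ℝ) : ℂ) := by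
    intro T
    rw [intervalIntegral.integral_eq_sub_of_hasDerivAt (fun y _ => hderiv y)
      (hcont.intervalIntegrable _ _), neg_div, Real.arctan_neg, neg_sq]
    push_cast
    ring
  simp only [hval]
  refine (continuous_ofReal.tendsto _).comp ?_
  rcases lt_or_gt_of_ne hc with h | h
  · rw [Real.sign_of_neg h]
    have h1 : Tendsto (fun T : ℝ => T / c) atTop atBot := tendsto_id.atTop_div_const_of_neg h
    have h2 := ((Real.tendsto_arctan_atBot.mono_right nhdsWithin_le_nhds).comp h1).const_mul 2
    rw [show Real.pi * -1 = 2 * -(Real.pi / 2) by ring]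
    exact h2
  · rw [Real.sign_of_pos h]
    have h1 : Tendsto (fun T : ℝ => T / c) atTop atTop := tendsto_id.atTop_div_const h
    have h2 := ((Real.tendsto_arctan_atTop.mono_right nhdsWithin_le_nhds).comp h1).const_mul 2
    rw [show Real.pi * 1 = 2 * (Real.pi / 2) by ring]
    exact h2

theorem min_mul_sqrt_le_norm (c y : ℝ) :
    min 1 |c| * Real.sqrt (1 + y ^ 2) ≤ ‖(c : ℂ) + y * I‖ := by
  rw [norm_add_mul_I]
  have h0 : 0 ≤ min 1 |c| := le_min zero_le_one (abs_nonneg c)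
  apply Real.le_sqrt_of_sq_le
  rw [mul_pow, Real.sq_sqrt (by positivity)]
  have h1 : (min 1 |c|) ^ 2 ≤ 1 := pow_le_one₀ h0 (min_le_left _ _)
  have h2 : (min 1 |c|) ^ 2 ≤ c ^ 2 := by
    rw [← sq_abs c]; exact pow_le_pow_left₀ h0 (min_le_right _ _) 2
  nlinarith [sq_nonneg y]

theorem integrable_div_mul_sub_one {G : ℂ → ℂ} {c C : ℝ}
    (hG : Continuous fun y : ℝ => G (c + y * I)) (h0 : c ≠ 0) (h1 : c ≠ 1)
    (hC : ∀ s : ℂ, s.re = c → ‖G s‖ ≤ C) :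
    Integrable fun y : ℝ => G (c + y * I) / ((c + y * I) * (c + y * I - 1)) := by
  have n0 : ∀ y : ℝ, (c : ℂ) + y * I ≠ 0 := fun y h => h0 (by simpa using congrArg Complex.re h)
  have n1 : ∀ y : ℝ, (c : ℂ) + y * I - 1 ≠ 0 := fun y h => h1 (by
    have := congrArg Complex.re h; simp at this; linarith)
  have hm0 : 0 < min 1 |c| := lt_min one_pos (abs_pos.mpr h0)
  have hm1 : 0 < min 1 |c - 1| := lt_min one_pos (abs_pos.mpr (sub_ne_zero.mpr h1))
  refine Integrable.mono' (integrable_inv_one_add_sq.const_mul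
    (C / (min 1 |c| * min 1 |c - 1|))) ?_ (ae_of_all _ fun y => ?_)
  · refine Continuous.aestronglyMeasurable ?_
    refine Continuous.div hG (by fun_prop) fun y => mul_ne_zero (n0 y) (n1 y)
  · have hGC := hC (c + y * I) (by simp)
    have hC0 : 0 ≤ C := (norm_nonneg _).trans hGC
    have e0 := min_mul_sqrt_le_norm c y
    have e1 := min_mul_sqrt_le_norm (c - 1) y
    rw [show ((c - 1 : ℝ) : ℂ) + y * I = c + y * I - 1 by push_cast; ring] at e1
    have hs : 0 < Real.sqrt (1 + y ^ 2) := Real.sqrt_pos.mpr (by positivity)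
    have e2 := mul_le_mul e0 e1 (by positivity) (norm_nonneg _)
    have e3 : min 1 |c| * Real.sqrt (1 + y ^ 2) * (min 1 |c - 1| * Real.sqrt (1 + y ^ 2)) =
        min 1 |c| * min 1 |c - 1| * (1 + y ^ 2) := by
      have := Real.mul_self_sqrt (by positivity : 0 ≤ 1 + y ^ 2)
      linear_combination (min 1 |c| * min 1 |c - 1|) * this
    rw [e3] at e2
    rw [norm_div, norm_mul, ← div_eq_mul_inv, div_div]
    exact div_le_div₀ hC0 hGC (by positivity) e2

/-- Removing both polar parts from G(s)/(s(s-1)) leaves an entire function H, a difference of two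
`dslope`s, so Cauchy's theorem on rectangles suffices. The polar parts integrate to ±π times G(1) or
G(0) on each line, with opposite signs at a and b; their jump is the residue contribution. -/
theorem contour_shift {G : ℂ → ℂ} (hG : Differentiable ℂ G) {a b C : ℝ} (ha : a < 0) (hb : 1 < b)
    (hC : ∀ s : ℂ, a ≤ s.re → s.re ≤ b → ‖G s‖ ≤ C) :
    (∫ y : ℝ, G (b + y * I) / ((b + y * I) * (b + y * I - 1))) -
      ∫ y : ℝ, G (a + y * I) / ((a + y * I) * (a + y * I - 1)) = 2 * Real.pi * (G 1 - G 0) := by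
  set H : ℂ → ℂ := fun s => dslope G 1 s - dslope G 0 s with hHdef
  have hH : Differentiable ℂ H := by
    have h : ∀ p : ℂ, Differentiable ℂ (dslope G p) := fun p => by
      rw [← differentiableOn_univ, differentiableOn_dslope univ_mem, differentiableOn_univ]
      exact hG
    exact (h 1).sub (h 0)
  have hHeq : ∀ s : ℂ, s ≠ 0 → s ≠ 1 →
      H s = G s / (s * (s - 1)) - G 1 * (s - 1)⁻¹ + G 0 * s⁻¹ := by
    intro s h0 h1
    have h1' : s - 1 ≠ 0 := sub_ne_zero.mpr h1
    simp only [hHdef, dslope_of_ne _ h0, dslope_of_ne _ h1, slope_def_field, sub_zero]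
    field_simp
    ring
  have hvert : ∀ c : ℝ, a ≤ c → c ≤ b → c ≠ 0 → c ≠ 1 →
      Tendsto (fun T : ℝ => ∫ y in (-T)..T, H (c + y * I)) atTop
        (𝓝 ((∫ y : ℝ, G (c + y * I) / ((c + y * I) * (c + y * I - 1))) -
          G 1 * (Real.pi * Real.sign (c - 1) : ℝ) +
          G 0 * (Real.pi * Real.sign c : ℝ))) := by
    intro c hac hcb h0 h1
    have n0 : ∀ y : ℝ, (c : ℂ) + y * I ≠ 0 := fun y h => h0 (by simpa using congrArg Complex.re h)
    have n1 : ∀ y : ℝ, ((c - 1 : ℝ) : ℂ) + y * I ≠ 0 := fun y h => h1 (by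
      have := congrArg Complex.re h; simp at this; linarith)
    have hint := integrable_div_mul_sub_one (hG.continuous.comp (by fun_prop)) h0 h1
      (fun s hs => hC s (by rw [hs]; exact hac) (by rw [hs]; exact hcb))
    have hcont0 : Continuous fun y : ℝ => G 0 * ((c : ℂ) + y * I)⁻¹ :=
      continuous_const.mul (Continuous.inv₀ (by fun_prop) n0)
    have hcont1 : Continuous fun y : ℝ => G 1 * (((c - 1 : ℝ) : ℂ) + y * I)⁻¹ :=
      continuous_const.mul (Continuous.inv₀ (by fun_prop) n1)
    have hJ := intervalIntegral_tendsto_integral hint tendsto_neg_atTop_atBot tendsto_id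
    have h2 := tendsto_integral_inv_vertical h0
    have h3 := tendsto_integral_inv_vertical (sub_ne_zero.mpr h1)
    refine ((hJ.sub (h3.const_mul (G 1))).add (h2.const_mul (G 0))).congr fun T => ?_
    rw [id, ← intervalIntegral.integral_const_mul, ← intervalIntegral.integral_const_mul,
      ← intervalIntegral.integral_sub hint.intervalIntegrable
        (hcont1.intervalIntegrable _ _),
      ← intervalIntegral.integral_add
        (hint.intervalIntegrable.sub (hcont1.intervalIntegrable _ _))
        (hcont0.intervalIntegrable _ _)]
    refine intervalIntegral.integral_congr fun y _ => ?_
    rw [hHeq _ (n0 y) (fun h => n1 y (by push_cast; linear_combination h))]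
    congr 4
    push_cast; ring
  -- Both horizontal sides at once, ε = ±1: H is O(1/T) there by its partial-fraction form.
  have hhor : ∀ ε : ℝ, |ε| = 1 →
      Tendsto (fun T : ℝ => ∫ x in a..b, H (x + (ε * T : ℝ) * I)) atTop (𝓝 0) := by
    intro ε hε
    have hlim : Tendsto (fun T : ℝ => (C * T⁻¹ * T⁻¹ + ‖G 1‖ * T⁻¹ + ‖G 0‖ * T⁻¹) * |b - a|) atTop
        (𝓝 0) := by
      have h := tendsto_inv_atTop_zero (𝕜 := ℝ)
      have := (((h.const_mul C).mul h).add (h.const_mul ‖G 1‖)).add (h.const_mul ‖G 0‖)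
      simpa using this.mul_const |b - a|
    refine squeeze_zero_norm' ?_ hlim
    filter_upwards [eventually_gt_atTop 0] with T hT
    refine intervalIntegral.norm_integral_le_of_norm_le_const fun x hx => ?_
    rw [Set.uIoc_of_le (by linarith)] at hx
    set s : ℂ := x + (ε * T : ℝ) * I with hs
    have hre : s.re = x := by simp [hs]
    have him : |s.im| = T := by
      have : s.im = ε * T := by simp [hs]
      rw [this, abs_mul, hε, one_mul, abs_of_pos hT]
    have b0 : T ≤ ‖s‖ := him ▸ abs_im_le_norm s
    have b1 : T ≤ ‖s - 1‖ := by
      have := abs_im_le_norm (s - 1)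
      simp only [sub_im, one_im, sub_zero, him] at this
      exact this
    have hs0 : s ≠ 0 := norm_pos_iff.mp (hT.trans_le b0)
    have hs1 : s - 1 ≠ 0 := norm_pos_iff.mp (hT.trans_le b1)
    have i0 : ‖s‖⁻¹ ≤ T⁻¹ := inv_anti₀ hT b0
    have i1 : ‖s - 1‖⁻¹ ≤ T⁻¹ := inv_anti₀ hT b1
    have hGC := hC s (by rw [hre]; exact hx.1.le) (by rw [hre]; exact hx.2)
    have hC0 : 0 ≤ C := (norm_nonneg _).trans hGC
    have hTi : 0 ≤ T⁻¹ := by positivity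
    rw [hHeq s hs0 (sub_ne_zero.mp hs1), div_eq_mul_inv, mul_inv, ← mul_assoc]
    refine (norm_add_le _ _).trans (add_le_add ((norm_sub_le _ _).trans (add_le_add ?_ ?_)) ?_)
    · rw [norm_mul, norm_mul, norm_inv, norm_inv]; gcongr
    · rw [norm_mul, norm_inv]; gcongr
    · rw [norm_mul, norm_inv]; gcongr
  have hrect : ∀ T : ℝ, (∫ x in a..b, H (x + ((-1) * T : ℝ) * I)) -
      (∫ x in a..b, H (x + (1 * T : ℝ) * I)) + I * (∫ y in (-T)..T, H (b + y * I)) -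
      I * (∫ y in (-T)..T, H (a + y * I)) = 0 := by
    intro T
    have := integral_boundary_rect_eq_zero_of_differentiableOn H ⟨a, -T⟩ ⟨b, T⟩ hH.differentiableOn
    simpa using this
  have hlim := (((hhor (-1) (by norm_num)).sub (hhor 1 (by norm_num))).add
    ((hvert b (by linarith) le_rfl (by linarith) hb.ne').const_mul I)).sub
    ((hvert a le_rfl (by linarith) ha.ne (by linarith)).const_mul I)
  have h0 := tendsto_nhds_unique (hlim.congr hrect) tendsto_const_nhds
  rw [Real.sign_of_pos (by linarith : 0 < b - 1), Real.sign_of_pos (by linarith : 0 < b),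
    Real.sign_of_neg (by linarith : a - 1 < 0), Real.sign_of_neg ha] at h0
  push_cast at h0
  have h1 : I * ((∫ y : ℝ, G (b + y * I) / ((b + y * I) * (b + y * I - 1))) -
      (∫ y : ℝ, G (a + y * I) / ((a + y * I) * (a + y * I - 1)))) =
      I * (2 * Real.pi * (G 1 - G 0)) := by linear_combination h0
  exact mul_left_cancel₀ I_ne_zero h1

/-! ### Mellin inversion and the series on a line Re s > 1. -/

namespace IsSchwartzHalfLine

variable {F : ℝ → ℂ}

theorem verticalIntegrable_mellin (hF : IsSchwartzHalfLine F) {σ : ℝ} (hσ : 0 < σ) :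
    VerticalIntegrable (mellin (reflDeriv F 0)) σ := by
  obtain ⟨C, _, hC⟩ := hF.exists_norm_mellin_le 2 (a := σ + 2) (b := σ + 2) (by linarith)
    (by linarith)
  -- Two integrations by parts give the transform as M₂(s + 2)/(s(s + 1)), with M₂ that of the
  -- second derivative. Shifting by one puts the denominator in the form z(z - 1) at z = s + 1.
  have h := integrable_div_mul_sub_one (G := fun s => mellin (reflDeriv F 2) (s + 1)) (c := σ + 1)
    (C := C) ?_ (by linarith) (by linarith) (fun s hs => hC _ (by simp [hs]; linarith)
      (by simp [hs]; linarith))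
  · refine h.congr (ae_of_all _ fun y => ?_)
    set s : ℂ := σ + y * I with hs
    have hre : 0 < s.re := by simpa [hs] using hσ
    have hs0 : s ≠ 0 := by intro h; rw [h] at hre; simp at hre
    have hs1 : s + 1 ≠ 0 := by intro h; have := congrArg Complex.re h; simp at this; linarith
    have e1 := hF.mellin_reflDeriv_succ 0 hre
    have e2 := hF.mellin_reflDeriv_succ 1 (s := s + 1) (by simp; linarith)
    have e3 : ((σ + 1 : ℝ) : ℂ) + y * I = s + 1 := by rw [hs]; push_cast; ring
    simp only [zero_add, Nat.reduceAdd] at e1 e2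
    simp only [e3, e2, e1, add_sub_cancel_right]
    rw [← hs]
    field_simp
  · refine continuous_iff_continuousAt.mpr fun y => ?_
    have hc : Continuous fun y : ℝ => ((σ + 1 : ℝ) : ℂ) + y * I + 1 := by fun_prop
    have hre : 0 < (((σ + 1 : ℝ) : ℂ) + y * I + 1).re := by simp; linarith
    exact ContinuousAt.comp (g := mellin (reflDeriv F 2)) (x := y)
      (hF.differentiableAt_mellin 2 hre).continuousAt hc.continuousAt

theorem mellinInv_mellin_reflDeriv (hF : IsSchwartzHalfLine F) {σ x : ℝ} (hσ : 0 < σ) (hx : 0 < x) :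
    mellinInv σ (mellin (reflDeriv F 0)) x = F (-x) := by
  rw [mellinInv_mellin_eq σ _ hx (hF.mellinConvergent 0 (by simpa using hσ))
    (hF.verticalIntegrable_mellin hσ) (hF.hasDerivAt_reflDeriv 0 hx).continuousAt, reflDeriv_zero]

theorem circleIntegrand_eq_mellin (hF : IsSchwartzHalfLine F) {s : ℂ} (hs : 0 < s.re) (t : ℝ) :
    circleIntegrand F t s = riemannZeta s * LChi4 s *
      (((-t : ℝ) : ℂ) ^ (-s) * mellin (reflDeriv F 0) s) := by
  have hG := Gamma_ne_zero_of_re_pos hs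
  rw [circleIntegrand, hF.fracDeriv_neg_eq 0 (by simpa using hs)]
  simp only [Nat.cast_zero, add_zero]
  field_simp

/-- Absolute convergence of the Dirichlet series times integrability of the Mellin transform
justifies exchanging sum and integral; each term is then Mellin inversion at -(n + 1)t. -/
theorem hasSum_circle (hF : IsSchwartzHalfLine F) {t σ : ℝ} (ht : t < 0) (hσ : 1 < σ) :
    HasSum (fun n : ℕ => (chi4DivisorSum (n + 1) : ℂ) *
        (2 * Real.pi * F (((n + 1 : ℕ) : ℝ) * t)))
      (∫ y : ℝ, circleIntegrand F t (σ + y * I)) := by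
  have hM := hF.verticalIntegrable_mellin (zero_lt_one.trans hσ)
  have hx : 0 < -t := neg_pos.mpr ht
  set f : ℕ → ℝ → ℂ := fun n y => (chi4DivisorSum (n + 1) : ℂ) *
    (((((n + 1 : ℕ) : ℝ) * -t : ℝ) : ℂ) ^ (-(σ + y * I)) *
      mellin (reflDeriv F 0) (σ + y * I)) with hf
  have hnorm : ∀ n y, ‖f n y‖ = |(chi4DivisorSum (n + 1) : ℝ)| * ((n + 1 : ℕ) : ℝ) ^ (-σ) *
      (-t) ^ (-σ) * ‖mellin (reflDeriv F 0) (σ + y * I)‖ := by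
    intro n y
    rw [hf]
    simp only
    rw [norm_mul, norm_mul, norm_cpow_eq_rpow_re_of_pos (by positivity), norm_intCast]
    have : (-(σ + y * I : ℂ)).re = -σ := by simp
    rw [this, Real.mul_rpow (by positivity) hx.le]
    ring
  have hint : ∀ n, Integrable (f n) := by
    intro n
    refine Integrable.const_mul ?_ _
    refine Integrable.bdd_mul (c := (((n + 1 : ℕ) : ℝ) * -t) ^ (-σ)) hM ?_ (ae_of_all _ fun y => ?_)
    · have : ((((n + 1 : ℕ) : ℝ) * -t : ℝ) : ℂ) ≠ 0 := by
        exact_mod_cast (by positivity : ((n + 1 : ℕ) : ℝ) * -t ≠ 0)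
      exact (Continuous.const_cpow (by fun_prop) (Or.inl this)).aestronglyMeasurable
    · rw [norm_cpow_eq_rpow_re_of_pos (by positivity)]
      simp
  have hsum : Summable fun n => ∫ y, ‖f n y‖ := by
    simp only [hnorm, integral_const_mul]
    exact ((summable_abs_chi4DivisorSum hσ).mul_right _).mul_right _
  have h := hasSum_integral_of_summable_integral_norm hint hsum
  have hR : ∀ y : ℝ, ∑' n, f n y = circleIntegrand F t (σ + y * I) := by
    intro y
    have h1 := (hasSum_chi4DivisorSum (s := σ + y * I) (by simpa using hσ)).mul_right
      (((-t : ℝ) : ℂ) ^ (-(σ + y * I : ℂ)) * mellin (reflDeriv F 0) (σ + y * I))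
    rw [hF.circleIntegrand_eq_mellin (by simpa using zero_lt_one.trans hσ), ← h1.tsum_eq]
    refine tsum_congr fun n => ?_
    simp only [hf]
    rw [ofReal_mul, mul_cpow_ofReal_nonneg (by positivity) hx.le]
    ring
  simp only [hR] at h
  refine h.congr_fun fun n => ?_
  simp only [hf]
  rw [integral_const_mul]
  congr 1
  have hmi := hF.mellinInv_mellin_reflDeriv (zero_lt_one.trans hσ)
    (by positivity : 0 < ((n + 1 : ℕ) : ℝ) * -t)
  have key : ∀ J v : ℂ, (1 / (2 * Real.pi)) • J = v → 2 * Real.pi * v = J := by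
    rintro J v rfl
    have hpi : (Real.pi : ℂ) ≠ 0 := by exact_mod_cast Real.pi_ne_zero
    rw [real_smul]
    push_cast
    field_simp
  rw [show -(((n + 1 : ℕ) : ℝ) * -t) = ((n + 1 : ℕ) : ℝ) * t by ring] at hmi
  exact key _ _ hmi

/-! ### Residues and the formula on lines Re s < 0. -/

theorem circleIntegrand_eq_div (F : ℝ → ℂ) (t : ℝ) {s : ℂ} (hs : ∀ n : ℕ, s ≠ -n) (h1 : s ≠ 1) :
    circleIntegrand F t s = circleW F s * ((-t : ℝ) : ℂ) ^ (-s) / (s * (s - 1)) := by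
  have h0 : s ≠ 0 := by simpa using hs 0
  have h1' : s - 1 ≠ 0 := sub_ne_zero.mpr h1
  rw [circleIntegrand, circleW, circleXi_eq hs h1]
  field_simp

/-- The exceptional points are real, so a vertical line meets them at most at y = 0, a null set. -/
theorem ae_circleIntegrand_eq_div (F : ℝ → ℂ) (t σ : ℝ) :
    (fun y : ℝ => circleIntegrand F t (σ + y * I)) =ᵐ[volume] fun y : ℝ =>
      circleW F (σ + y * I) * ((-t : ℝ) : ℂ) ^ (-(σ + y * I : ℂ)) /
        ((σ + y * I) * (σ + y * I - 1)) := by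
  filter_upwards [Measure.ae_ne volume (0 : ℝ)] with y hy
  refine circleIntegrand_eq_div F t (fun n h => hy ?_) (fun h => hy ?_)
  · simpa using congrArg Complex.im h
  · simpa using congrArg Complex.im h

theorem exists_norm_circleW_mul_cpow_le (hF : IsSchwartzHalfLine F) {t a b : ℝ} (ht : t < 0)
    (ha : a < 0) (hb : 1 < b) : ∃ C : ℝ, ∀ s : ℂ, a ≤ s.re → s.re ≤ b →
      ‖circleW F s * ((-t : ℝ) : ℂ) ^ (-s)‖ ≤ C := by
  obtain ⟨C, hC⟩ := hF.exists_norm_circleW_le ha hb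
  have hx : 0 < -t := neg_pos.mpr ht
  refine ⟨C * ((-t) ^ (-b) + (-t) ^ (-a)), fun s h1 h2 => ?_⟩
  have h := hC s h1 h2
  rw [norm_mul, norm_cpow_eq_rpow_re_of_pos hx, neg_re]
  exact mul_le_mul h (rpow_le_add_of_mem_Icc hx (by linarith) (by linarith))
    (Real.rpow_nonneg hx.le _) ((norm_nonneg _).trans h)

theorem differentiable_circleW_mul_cpow (hF : IsSchwartzHalfLine F) {t : ℝ} (ht : t < 0) :
    Differentiable ℂ fun s : ℂ => circleW F s * ((-t : ℝ) : ℂ) ^ (-s) :=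
  hF.differentiable_circleW.mul (differentiable_neg.const_cpow
    (Or.inl (by exact_mod_cast (neg_pos.mpr ht).ne')))

theorem verticalIntegrable_circleIntegrand (hF : IsSchwartzHalfLine F) {t σ : ℝ} (ht : t < 0)
    (h0 : σ ≠ 0) (h1 : σ ≠ 1) : VerticalIntegrable (circleIntegrand F t) σ := by
  obtain ⟨C, hC⟩ := hF.exists_norm_circleW_mul_cpow_le ht (a := min σ (-1)) (b := max σ 2)
    ((min_le_right _ _).trans_lt (by norm_num)) (lt_of_lt_of_le (by norm_num) (le_max_right _ _))
  refine Integrable.congr (integrable_div_mul_sub_one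
    (G := fun s => circleW F s * ((-t : ℝ) : ℂ) ^ (-s)) (C := C)
    ((hF.differentiable_circleW_mul_cpow ht).continuous.comp (by fun_prop)) h0 h1 fun s hs =>
      hC s (by rw [hs]; exact min_le_left _ _) (by rw [hs]; exact le_max_left _ _))
    (ae_circleIntegrand_eq_div F t σ).symm

theorem integral_circleIntegrand_sub (hF : IsSchwartzHalfLine F) {t a b : ℝ} (ht : t < 0)
    (ha : a < 0) (hb : 1 < b) :
    (∫ y : ℝ, circleIntegrand F t (b + y * I)) - ∫ y : ℝ, circleIntegrand F t (a + y * I) =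
      2 * Real.pi * (-(LChi4 1 / t) * fracDeriv F (-1) - LChi4 0 / 2 * F 0) := by
  obtain ⟨C, hC⟩ := hF.exists_norm_circleW_mul_cpow_le ht ha hb
  rw [integral_congr_ae (ae_circleIntegrand_eq_div F t b),
    integral_congr_ae (ae_circleIntegrand_eq_div F t a),
    contour_shift (hF.differentiable_circleW_mul_cpow ht) ha hb hC]
  simp only [circleW, circleXi_one, circleXi_zero, neg_zero, hF.fracDeriv_zero, cpow_zero,
    cpow_neg_one]
  have ht0 : (t : ℂ) ≠ 0 := by exact_mod_cast ht.ne
  push_cast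
  field_simp

theorem tsum_circle (hF : IsSchwartzHalfLine F) {t σ : ℝ} (ht : t < 0) (hσ : 1 < σ) :
    Summable (fun n : ℕ => (sumTwoSquaresCount (n + 1) : ℂ) * F (((n + 1 : ℕ) : ℝ) * t)) ∧
      ∫ y : ℝ, circleIntegrand F t (σ + y * I) = 2 * Real.pi * (1 / 4 * circleSum F t) := by
  have h := (hF.hasSum_circle ht hσ).mul_left (4 / (2 * Real.pi) : ℂ)
  have hpi : (Real.pi : ℂ) ≠ 0 := by exact_mod_cast Real.pi_ne_zero
  have h' : HasSum (fun n : ℕ => (sumTwoSquaresCount (n + 1) : ℂ) * F (((n + 1 : ℕ) : ℝ) * t))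
      (4 / (2 * Real.pi) * ∫ y : ℝ, circleIntegrand F t (σ + y * I)) := by
    refine h.congr_fun fun n => ?_
    have e : ((sumTwoSquaresCount (n + 1) : ℤ) : ℂ) = ((4 * chi4DivisorSum (n + 1) : ℤ) : ℂ) :=
      congrArg _ (sumTwoSquaresCount_eq n.succ_ne_zero)
    push_cast at e
    rw [e]
    field_simp
  refine ⟨h'.summable, ?_⟩
  rw [circleSum, h'.tsum_eq]
  generalize (∫ y : ℝ, circleIntegrand F t (σ + y * I)) = J
  field_simp

theorem circleSum_eq (hF : IsSchwartzHalfLine F) {t a : ℝ} (ht : t < 0) (ha : a < 0) :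
    1 / 4 * circleSum F t = -(LChi4 1 / t) * fracDeriv F (-1) - LChi4 0 / 2 * F 0 +
      1 / (2 * I * Real.pi) * verticalIntegral a (circleIntegrand F t) := by
  have h1 := hF.integral_circleIntegrand_sub ht ha (b := 3 / 2) (by norm_num)
  rw [(hF.tsum_circle ht (σ := 3 / 2) (by norm_num)).2] at h1
  have hpi : (Real.pi : ℂ) ≠ 0 := by exact_mod_cast Real.pi_ne_zero
  have hc : 1 / (2 * I * Real.pi) * verticalIntegral a (circleIntegrand F t) =
      1 / (2 * Real.pi) * ∫ y : ℝ, circleIntegrand F t (a + y * I) := by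
    rw [verticalIntegral]
    have := I_ne_zero
    field_simp
  have hone : (1 / (2 * Real.pi) : ℂ) * (2 * Real.pi) = 1 := by field_simp
  rw [hc]
  linear_combination (1 / (2 * Real.pi) : ℂ) * h1 - (1 / 4 * circleSum F t -
    (-(LChi4 1 / t) * fracDeriv F (-1) - LChi4 0 / 2 * F 0)) * hone

/-! ### The reflected integrals and the expansion at 0⁻. -/

/-- The integrand `Γ(-s) ζ(-s) L(-s, χ₄) F^{(s)}(0) (-t)^s`. -/
noncomputable def circleIntegrandNeg (F : ℝ → ℂ) (t : ℝ) (s : ℂ) : ℂ :=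
  Gamma (-s) * riemannZeta (-s) * LChi4 (-s) * fracDeriv F s * ((-t : ℝ) : ℂ) ^ s

theorem circleIntegrandNeg_eq (F : ℝ → ℂ) (t c y : ℝ) :
    circleIntegrandNeg F t (c + y * I) = circleIntegrand F t (((-c : ℝ) : ℂ) + (-y : ℝ) * I) := by
  have : ((-c : ℝ) : ℂ) + (-y : ℝ) * I = -(c + y * I) := by push_cast; ring
  rw [this, circleIntegrand, circleIntegrandNeg, neg_neg]

theorem verticalIntegrable_circleIntegrandNeg (hF : IsSchwartzHalfLine F) {t c : ℝ} (ht : t < 0)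
    (hc : 0 < c) : VerticalIntegrable (circleIntegrandNeg F t) c := by
  have h := (hF.verticalIntegrable_circleIntegrand ht (σ := -c) (by linarith) (by linarith)).comp_neg
  exact h.congr (ae_of_all _ fun y => (circleIntegrandNeg_eq F t c y).symm)

theorem verticalIntegral_circleIntegrandNeg (F : ℝ → ℂ) (t c : ℝ) :
    verticalIntegral c (circleIntegrandNeg F t) = verticalIntegral (-c : ℝ) (circleIntegrand F t) := by
  rw [verticalIntegral, verticalIntegral]
  simp only [circleIntegrandNeg_eq]
  rw [integral_neg_eq_self fun y : ℝ => circleIntegrand F t (((-c : ℝ) : ℂ) + y * I)]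

/-- The functional equation links s + 1 and -s, and ξξ₄ is 2π^{-s}ΓζL. Keeping s off the real axis
avoids the poles, where Lean's default values could break the identity. -/
theorem circleXiIntegrand_eq {F : ℝ → ℂ} {t : ℝ} (ht : t < 0) {s : ℂ} (hs : s.im ≠ 0) :
    circleXiIntegrand F t s = 2 * circleIntegrandNeg F t s := by
  have hpi : (Real.pi : ℂ) ≠ 0 := by exact_mod_cast Real.pi_ne_zero
  have hne : ∀ z : ℂ, z.im = 0 → s ≠ z := fun z hz h => hs (h ▸ hz)
  have h0 : s ≠ 0 := hne 0 rfl
  have h1 : s + 1 ≠ 0 := fun h => hne (-1) (by simp) (eq_neg_of_add_eq_zero_left h)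
  have e := circleXi_one_sub (s + 1)
  rw [show 1 - (s + 1) = -s by ring, circleXi_eq, circleXi_eq] at e
  · have e' : Gamma (-s) * riemannZeta (-s) * LChi4 (-s) = (Real.pi : ℂ) ^ (1 - 2 * (s + 1)) *
        (Gamma (s + 1) * riemannZeta (s + 1) * LChi4 (s + 1)) := by
      refine mul_left_cancel₀ (mul_ne_zero h0 h1) ?_
      linear_combination e
    have hp : (Real.pi : ℂ) ^ (-(s + 1)) * ((Real.pi : ℂ) ^ s)⁻¹ =
        (Real.pi : ℂ) ^ (1 - 2 * (s + 1)) := by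
      rw [← cpow_neg, ← cpow_add _ _ hpi]; congr 1; ring
    have hd : ((-t / Real.pi : ℝ) : ℂ) ^ s = ((-t : ℝ) : ℂ) ^ s * ((Real.pi : ℂ) ^ s)⁻¹ := by
      rw [ofReal_div, div_cpow_ofReal_nonneg (neg_pos.mpr ht).le Real.pi_pos.le, div_eq_mul_inv]
    rw [circleXiIntegrand, circleIntegrandNeg, xiZeta_mul_xiChi4, e', ← hp, hd]
    ring
  · intro n h
    exact hne (-n - 1) (by simp) (by linear_combination h)
  · intro h
    exact h0 (by linear_combination h)
  · intro n h
    exact hne n (by simp) (neg_injective h)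
  · intro h
    exact hne (-1) (by simp) (by linear_combination -h)

theorem ae_circleXiIntegrand_eq {F : ℝ → ℂ} {t : ℝ} (ht : t < 0) (c : ℝ) :
    (fun y : ℝ => circleXiIntegrand F t (c + y * I)) =ᵐ[volume]
      fun y : ℝ => 2 * circleIntegrandNeg F t (c + y * I) := by
  filter_upwards [Measure.ae_ne volume (0 : ℝ)] with y hy
  exact circleXiIntegrand_eq ht (by simpa using hy)

theorem circleSum_eq_neg (hF : IsSchwartzHalfLine F) {t c : ℝ} (ht : t < 0) (hc : 0 < c) :
    1 / 4 * circleSum F t = -(Real.pi / (4 * t)) * fracDeriv F (-1) - 1 / 4 * F 0 +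
      1 / (2 * I * Real.pi) * verticalIntegral c (circleIntegrandNeg F t) := by
  rw [verticalIntegral_circleIntegrandNeg, hF.circleSum_eq ht (neg_lt_zero.mpr hc), LChi4_one,
    LChi4_zero]
  congr 2
  · rw [div_div]
  · norm_num

/-- In the remainder t occurs only through (-t)^s, of modulus (-t)^c on the line, so the integral of
the norm at t = -1 serves as constant. -/
theorem circleSum_sub_isBigO (hF : IsSchwartzHalfLine F) {c : ℝ} (hc : 0 < c) :
    (fun t : ℝ => 1 / 4 * circleSum F t -
      (-(Real.pi / (4 * t)) * fracDeriv F (-1) - 1 / 4 * F 0)) =O[𝓝[<] (0 : ℝ)]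
        (fun t : ℝ => (-t) ^ c) := by
  refine Asymptotics.IsBigO.of_bound (1 / (2 * Real.pi) *
    ∫ y : ℝ, ‖circleIntegrandNeg F (-1) (c + y * I)‖) ?_
  filter_upwards [self_mem_nhdsWithin] with t ht
  have ht' : t < 0 := ht
  have hx : 0 < -t := neg_pos.mpr ht'
  rw [hF.circleSum_eq_neg ht' hc, add_sub_cancel_left, verticalIntegral, norm_mul, norm_mul, norm_I,
    one_mul, Real.norm_of_nonneg (Real.rpow_nonneg hx.le c)]
  have h1 : ‖(1 / (2 * I * Real.pi) : ℂ)‖ = 1 / (2 * Real.pi) := by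
    simp [abs_of_pos Real.pi_pos]
  have h2 : ∀ y : ℝ, ‖circleIntegrandNeg F t (c + y * I)‖ =
      ‖circleIntegrandNeg F (-1) (c + y * I)‖ * (-t) ^ c := by
    intro y
    simp only [circleIntegrandNeg, norm_mul, neg_neg, ofReal_one, one_cpow, mul_one]
    rw [norm_cpow_eq_rpow_re_of_pos hx]
    simp
  rw [h1, mul_assoc]
  refine mul_le_mul_of_nonneg_left ?_ (by positivity)
  refine (norm_integral_le_integral_norm _).trans (le_of_eq ?_)
  simp only [h2, integral_mul_const]

end IsSchwartzHalfLine

theorem mainTheorem6 (F : ℝ → ℂ) (hF : IsSchwartzHalfLine F) :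
    -- `s ↦ F^{(s)}(0)` is the entire extension of the fractional primitive
    (Differentiable ℂ (fracDeriv F) ∧
      ∀ s : ℂ, s.re < 0 → fracDeriv F s = fracPrimitive F s) ∧
    -- the Euler-Circle formula, with convergence of the series and of all integrals
    (∀ t : ℝ, t < 0 →
      Summable (fun n : ℕ =>
        (sumTwoSquaresCount (n + 1) : ℂ) * F (((n + 1 : ℕ) : ℝ) * t)) ∧
      Complex.VerticalIntegrable (circleIntegrand F t) (3 / 2) ∧
      1 / (2 * Complex.I * Real.pi) * verticalIntegral (3 / 2) (circleIntegrand F t) =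
        1 / 4 * circleSum F t ∧
      Complex.VerticalIntegrable (circleIntegrand F t) (-1 / 2) ∧
      1 / 4 * circleSum F t =
        -(LChi4 1 / t) * fracDeriv F (-1) - LChi4 0 / 2 * F 0 +
          1 / (2 * Complex.I * Real.pi) * verticalIntegral (-1 / 2) (circleIntegrand F t) ∧
      1 / 4 * circleSum F t =
        -(Real.pi / (4 * t)) * fracDeriv F (-1) - 1 / 4 * F 0 +
          1 / (2 * Complex.I * Real.pi) * verticalIntegral (-1 / 2) (circleIntegrand F t) ∧
      ∀ c : ℝ, 0 < c →
        Complex.VerticalIntegrable (fun s : ℂ => Complex.Gamma (-s) * riemannZeta (-s) *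
          LChi4 (-s) * fracDeriv F s * ((-t : ℝ) : ℂ) ^ s) c ∧
        1 / 4 * circleSum F t =
          -(Real.pi / (4 * t)) * fracDeriv F (-1) - 1 / 4 * F 0 +
            1 / (2 * Complex.I * Real.pi) *
              verticalIntegral c (fun s : ℂ => Complex.Gamma (-s) * riemannZeta (-s) *
                LChi4 (-s) * fracDeriv F s * ((-t : ℝ) : ℂ) ^ s) ∧
        Complex.VerticalIntegrable (circleXiIntegrand F t) c ∧
        1 / 4 * circleSum F t =
          -(Real.pi / (4 * t)) * fracDeriv F (-1) - 1 / 4 * F 0 +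
            1 / (4 * Complex.I * Real.pi) * verticalIntegral c (circleXiIntegrand F t)) ∧
    -- the regular part of the expansion at `0⁻` is the constant `-F(0)/4`, to every order
    (∀ c : ℝ, 0 < c →
      (fun t : ℝ => 1 / 4 * circleSum F t -
          (-(Real.pi / (4 * t)) * fracDeriv F (-1) - 1 / 4 * F 0)) =O[𝓝[<] (0 : ℝ)]
        (fun t : ℝ => (-t) ^ c)) := by
  refine ⟨hF.fracDeriv_spec, fun t ht => ?_, fun c hc => hF.circleSum_sub_isBigO hc⟩
  obtain ⟨hsum, hint⟩ := hF.tsum_circle ht (σ := 3 / 2) (by norm_num)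
  have hpi : (Real.pi : ℂ) ≠ 0 := by exact_mod_cast Real.pi_ne_zero
  have hI := I_ne_zero
  have hhalf := hF.circleSum_eq ht (a := -1 / 2) (by norm_num)
  refine ⟨hsum, hF.verticalIntegrable_circleIntegrand ht (by norm_num) (by norm_num), ?_,
    hF.verticalIntegrable_circleIntegrand ht (by norm_num) (by norm_num), hhalf, ?_,
    fun c hc => ⟨hF.verticalIntegrable_circleIntegrandNeg ht hc, hF.circleSum_eq_neg ht hc, ?_, ?_⟩⟩
  · rw [verticalIntegral, hint]
    field_simp
  · rw [hhalf, LChi4_one, LChi4_zero, div_div]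
    norm_num
  · exact ((hF.verticalIntegrable_circleIntegrandNeg ht hc).const_mul 2).congr
      (IsSchwartzHalfLine.ae_circleXiIntegrand_eq ht c).symm
  · rw [hF.circleSum_eq_neg ht hc, verticalIntegral, verticalIntegral,
      integral_congr_ae (IsSchwartzHalfLine.ae_circleXiIntegrand_eq ht c), integral_const_mul]
    generalize (∫ y : ℝ, IsSchwartzHalfLine.circleIntegrandNeg F t (c + y * I)) = J
    congr 1
    field_simp
    ring
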